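/- **Conventions.** All vector lattices and linear maps are real; vector lattice homomorphisms are linear maps preserving finite suprema and infima. $\langle A\rangle$ is the vector sublattice generated by $A$. For $m\ge 1$, $\mathcal{H}(\mathbb{R}^m)$ is the set of continuous $h:\mathbb{R}^m\to\mathbb{R}$ with $h(\lambda x)=\lambda h(x)$ for all real $\lambda\ge 0$ and all $x\in\mathbb{R}^m$; write $\delta(h)=m$ for $h\in\mathcal{H}(\mathbb{R}^m)$. For an Archimedean vector lattice $F$, $a_1,\dots,a_m,b\in F$ and $h\in\mathcal{H}(\mathbb{R}^m)$, we write $h(a_1,\dots,a_m)=b$ if $h(\omega(a_1),\dots,\omega(a_m))=\omega(b)$ for every nonzero vector lattice homomorphism $\omega:\langle a_1,\dots,a_m,b\rangle\to\mathbb{R}$. For a set $\mathcal{D}\subseteq\bigcup_{m\ge1}\mathcal{H}(\mathbb{R}^m)$, $F$ is *$\mathcal{D}$-complete* if for all $h\in\mathcal{D}$ and $a_1,\dots,a_{\delta(h)}\in F$ there is $b\in F$ with $h(a_1,\dots,a_{\delta(h)})=b$. $F$ is *uniformly complete* if every relatively uniformly Cauchy sequence $(f_n)$ in $F$ (for some $p>0$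 in $F$ and every $\varepsilon>0$, eventually $|f_m-f_n|<\varepsilon p$) converges relatively uniformly to some $f\in F$ (for some $p>0$ in $F$ and every $\varepsilon>0$, eventually $|f_n-f|<\varepsilon p$). A *$\mathcal{D}$-completion* of an Archimedean vector lattice $E$ is a pair $(G,\phi)$ such that $G$ is a $\mathcal{D}$-complete Archimedean vector lattice, $\phi:E\to G$ is an injective vector lattice homomorphism, and for every $\mathcal{D}$-complete Archimedean vector lattice $F$ and every vector lattice homomorphism $T:E\to F$ there is a unique vector lattice homomorphism $S:G\to F$ with $S\circ\phi=T$. A *uniform completion* of $E$ is defined in the same way with "uniformly complete" in place of "$\mathcal{D}$-complete". **Corollary 3.19.** Let $E$ be an Archimedean vector lattice and let $\mathcal{D}\subseteq\bigcup_{m\ge1}\mathcal{H}(\mathbb{R}^m)$ be nonempty. Then $E$ has a uniform completion. Let $(E^u,\phi)$ be any uniform completion of $E$, put $E_1=\phi(E)$ and, for $n\ge1$, $$E_{n+1}=\big\langle E_n\cup\{b\in E^u : b=h(a_1,\dots,a_{\delta(h)})\text{ for some }h\in\mathcal{D},\ a_1,\dots,a_{\delta(h)}\in E_n\}\big\rangle\subseteq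 E^u,$$ and let $E^{\mathcal{D}}=\bigcup_{n\ge1}E_n$, with natural embedding $\iota:E\to E^{\mathcal{D}}$, $\iota(x)=\phi(x)$. Then $(E^{\mathcal{D}},\iota)$ is a $\mathcal{D}$-completion of $E$, and it is the unique one: for every $\mathcal{D}$-completion $(G,\psi)$ of $E$ there is a unique vector lattice isomorphism $e:E^{\mathcal{D}}\to G$ with $e\circ\iota=\psi$. -/

import Mathlib

/-!  Vector lattices are real vector spaces with a lattice order, given by Mathlib's classes
`AddCommGroup`, `Lattice`, `Module ℝ`, `IsOrderedAddMonoid`, `IsOrderedModule ℝ`. -/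

universe u v w

namespace FunctionalCompletion

section Basic

variable (E : Type*) [AddCommGroup E] [Lattice E] [Module ℝ E]

/-- The Archimedean property of a vector lattice: if all multiples `n x` lie below a fixed `y`,
then `x ≤ 0`.  (Mathlib's `Archimedean` is a different, much stronger condition on partially
ordered groups.) -/
def IsArchimedean : Prop :=
  ∀ x y : E, (∀ n : ℕ, n • x ≤ y) → x ≤ 0

variable {E}

/-- `f n` converges relatively uniformly to `g`. -/
def RUConverges (f : ℕ → E) (g : E) : Prop :=
  ∃ p : E, 0 < p ∧ ∀ ε : ℝ, 0 < ε → ∃ N : ℕ, ∀ n, N ≤ n → |f n - g| < ε • p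

/-- `f` is a relatively uniformly Cauchy sequence. -/
def RUCauchy (f : ℕ → E) : Prop :=
  ∃ p : E, 0 < p ∧ ∀ ε : ℝ, 0 < ε →
    ∃ N : ℕ, ∀ m n, N ≤ m → N ≤ n → |f m - f n| < ε • p

variable (E) in
/-- Uniform completeness of a vector lattice. -/
def UniformlyComplete : Prop :=
  ∀ f : ℕ → E, RUCauchy f → ∃ g : E, RUConverges f g

end Basic

/-- Vector lattice homomorphisms: linear maps that preserve finite suprema and infima. -/
structure VLHom (E F : Type*) [AddCommGroup E] [Lattice E] [Module ℝ E]
    [AddCommGroup F] [Lattice F] [Module ℝ F] extends E →ₗ[ℝ] F where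
  map_sup' : ∀ x y : E, toFun (x ⊔ y) = toFun x ⊔ toFun y
  map_inf' : ∀ x y : E, toFun (x ⊓ y) = toFun x ⊓ toFun y

instance VLHom.instFunLike {E F : Type*} [AddCommGroup E] [Lattice E] [Module ℝ E]
    [AddCommGroup F] [Lattice F] [Module ℝ F] : FunLike (VLHom E F) E F where
  coe T := T.toLinearMap
  coe_injective := by
    rintro ⟨S, _, _⟩ ⟨T, _, _⟩ h
    obtain rfl : S = T := DFunLike.coe_injective h
    rfl

/-- Vector sublattices: linear subspaces closed under the lattice operations. -/
structure VectorSublattice (E : Type*) [AddCommGroup E] [Lattice E] [Module ℝ E]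
    extends Submodule ℝ E where
  sup_mem' : ∀ x y : E, x ∈ carrier → y ∈ carrier → x ⊔ y ∈ carrier
  inf_mem' : ∀ x y : E, x ∈ carrier → y ∈ carrier → x ⊓ y ∈ carrier

namespace VectorSublattice

variable {E : Type*} [AddCommGroup E] [Lattice E] [Module ℝ E]

instance instSetLike : SetLike (VectorSublattice E) E where
  coe L := L.carrier
  coe_injective := by
    rintro ⟨L, _, _⟩ ⟨M, _, _⟩ h
    obtain rfl : L = M := SetLike.coe_injective h
    rfl

instance instAddSubgroupClass : AddSubgroupClass (VectorSublattice E) E where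
  add_mem {L} _ _ hx hy := L.toSubmodule.add_mem hx hy
  zero_mem L := L.toSubmodule.zero_mem
  neg_mem {L} _ hx := L.toSubmodule.neg_mem hx

instance instSMulMemClass : SMulMemClass (VectorSublattice E) ℝ E where
  smul_mem {L} c _ hx := L.toSubmodule.smul_mem c hx

/-- The lattice operations of a vector sublattice are those of the ambient space. -/
instance instLattice (L : VectorSublattice E) : Lattice L :=
  Subtype.lattice (fun {x y} hx hy => L.sup_mem' x y hx hy)
    (fun {x y} hx hy => L.inf_mem' x y hx hy)

instance instIsOrderedAddMonoid [IsOrderedAddMonoid E] (L : VectorSublattice E) :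
    IsOrderedAddMonoid L where
  add_le_add_left _ _ h c := add_le_add_left (α := E) h c

instance instIsOrderedModule [IsOrderedAddMonoid E] [IsOrderedModule ℝ E]
    (L : VectorSublattice E) : IsOrderedModule ℝ L where
  smul_le_smul_of_nonneg_left _ ha _ _ hb := smul_le_smul_of_nonneg_left (β := E) hb ha
  smul_le_smul_of_nonneg_right _ hb _ _ ha := smul_le_smul_of_nonneg_right (β := E) ha hb

/-- The vector sublattice `⟨A⟩` generated by a set `A`: the intersection of all vector
sublattices that contain `A`. -/
def closure (A : Set E) : VectorSublattice E where
  carrier := {x | ∀ L : VectorSublattice E, A ⊆ L → x ∈ L}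
  add_mem' hx hy L hL := add_mem (hx L hL) (hy L hL)
  zero_mem' L _ := zero_mem L
  smul_mem' c _ hx L hL := SMulMemClass.smul_mem c (hx L hL)
  sup_mem' x y hx hy L hL := L.sup_mem' x y (hx L hL) (hy L hL)
  inf_mem' x y hx hy L hL := L.inf_mem' x y (hx L hL) (hy L hL)

theorem subset_closure (A : Set E) : A ⊆ closure A := fun _ hx _ hL => hL hx

/-- The union of an increasing sequence of vector sublattices. -/
def iUnionOfMonotone (L : ℕ → VectorSublattice E) (hL : ∀ n, (L n : Set E) ⊆ L (n + 1)) :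
    VectorSublattice E :=
  have hmono : ∀ {m n : ℕ}, m ≤ n → (L m : Set E) ⊆ L n :=
    fun {_ _} h => monotone_nat_of_le_succ (f := fun n => (L n : Set E)) hL h
  have hpair : ∀ {x y : E}, (∃ n, x ∈ L n) → (∃ n, y ∈ L n) → ∃ n, x ∈ L n ∧ y ∈ L n := by
    rintro x y ⟨m, hm⟩ ⟨n, hn⟩
    exact ⟨max m n, hmono (le_max_left m n) hm, hmono (le_max_right m n) hn⟩
  { carrier := {x | ∃ n, x ∈ L n}
    add_mem' := fun hx hy => (hpair hx hy).imp fun _ h => add_mem h.1 h.2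
    zero_mem' := ⟨0, zero_mem (L 0)⟩
    smul_mem' := fun c _ hx => hx.imp fun _ h => SMulMemClass.smul_mem c h
    sup_mem' := fun x y hx hy => (hpair hx hy).imp fun n h => (L n).sup_mem' x y h.1 h.2
    inf_mem' := fun x y hx hy => (hpair hx hy).imp fun n h => (L n).inf_mem' x y h.1 h.2 }

end VectorSublattice

/-- The range of a vector lattice homomorphism. -/
def VLHom.range {E F : Type*} [AddCommGroup E] [Lattice E] [Module ℝ E]
    [AddCommGroup F] [Lattice F] [Module ℝ F] (φ : VLHom E F) : VectorSublattice F where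
  toSubmodule := LinearMap.range φ.toLinearMap
  sup_mem' := by
    rintro _ _ ⟨x, rfl⟩ ⟨y, rfl⟩
    exact ⟨x ⊔ y, φ.map_sup' x y⟩
  inf_mem' := by
    rintro _ _ ⟨x, rfl⟩ ⟨y, rfl⟩
    exact ⟨x ⊓ y, φ.map_inf' x y⟩

/-- A vector lattice homomorphism with values in a vector sublattice, regarded as a map into
that sublattice. -/
def VLHom.codRestrict {E F : Type*} [AddCommGroup E] [Lattice E] [Module ℝ E]
    [AddCommGroup F] [Lattice F] [Module ℝ F] (φ : VLHom E F) (L : VectorSublattice F)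
    (hL : ∀ x, φ x ∈ L) : VLHom E L where
  toFun x := ⟨φ x, hL x⟩
  map_add' x y := Subtype.ext (φ.map_add' x y)
  map_smul' c x := Subtype.ext (φ.map_smul' c x)
  map_sup' x y := Subtype.ext (φ.map_sup' x y)
  map_inf' x y := Subtype.ext (φ.map_inf' x y)

/-- The union over all `m ≥ 1` of the spaces `H(ℝ^m)` of continuous positively-homogeneous
real functions on `ℝ^m`; an element carries its number `arity` of variables. -/
structure HFun where
  arity : ℕ
  arity_pos : 0 < arity
  toFun : (Fin arity → ℝ) → ℝ
  continuous : Continuous toFun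
  homogeneous : ∀ (c : ℝ) (x : Fin arity → ℝ), 0 ≤ c → toFun (c • x) = c * toFun x

section Calculus

variable {E : Type*} [AddCommGroup E] [Lattice E] [Module ℝ E]

/-- The relation `h(a₁, …, a_m) = b` of functional calculus:
`h(ω(a₁), …, ω(a_m)) = ω(b)` for every nonzero real-valued vector lattice homomorphism `ω` on
the vector sublattice generated by `a₁, …, a_m, b`. -/
def CalcEq (h : HFun) (a : Fin h.arity → E) (b : E) : Prop :=
  ∀ ω : VLHom (VectorSublattice.closure (Set.range a ∪ {b})) ℝ, (∃ x, ω x ≠ 0) →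
    h.toFun (fun i => ω ⟨a i, VectorSublattice.subset_closure _ (Or.inl ⟨i, rfl⟩)⟩) =
      ω ⟨b, VectorSublattice.subset_closure _ (Or.inr rfl)⟩

variable (E) in
/-- `E` is `D`-complete: `h(a₁, …, a_m)` exists in `E` for all `h ∈ D` and `a₁, …, a_m ∈ E`. -/
def DComplete (D : Set HFun) : Prop :=
  ∀ h ∈ D, ∀ a : Fin h.arity → E, ∃ b : E, CalcEq h a b

end Calculus

section Completions

variable {E : Type u} [AddCommGroup E] [Lattice E] [Module ℝ E]
  {G : Type v} [AddCommGroup G] [Lattice G] [Module ℝ G]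

/-- `(G, φ)` is a uniform completion of `E`; the universal property is tested on uniformly
complete Archimedean vector lattices in `Type w`. -/
structure IsUniformCompletion (φ : VLHom E G) : Prop where
  archimedean : IsArchimedean G
  uniformlyComplete : UniformlyComplete G
  injective : Function.Injective φ
  universal : ∀ (F : Type w) [AddCommGroup F] [Lattice F] [Module ℝ F] [IsOrderedAddMonoid F]
    [IsOrderedModule ℝ F], IsArchimedean F → UniformlyComplete F →
    ∀ T : VLHom E F, ∃! S : VLHom G F, ∀ x : E, S (φ x) = T x

/-- `(G, φ)` is a `D`-completion of `E`; the universal property is tested on `D`-complete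
Archimedean vector lattices in `Type w`. -/
structure IsDCompletion (D : Set HFun) (φ : VLHom E G) : Prop where
  archimedean : IsArchimedean G
  dComplete : DComplete G D
  injective : Function.Injective φ
  universal : ∀ (F : Type w) [AddCommGroup F] [Lattice F] [Module ℝ F] [IsOrderedAddMonoid F]
    [IsOrderedModule ℝ F], IsArchimedean F → DComplete F D →
    ∀ T : VLHom E F, ∃! S : VLHom G F, ∀ x : E, S (φ x) = T x

/-- One step of the construction: the vector sublattice generated by `L` and all elements
`h(a₁, …, a_m)` with `h ∈ D` and `a₁, …, a_m ∈ L`. -/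
def dStep (D : Set HFun) (L : VectorSublattice G) : VectorSublattice G :=
  VectorSublattice.closure ((L : Set G) ∪
    {b | ∃ h ∈ D, ∃ a : Fin h.arity → G, (∀ i, a i ∈ L) ∧ CalcEq h a b})

/-- The chain `E₁ = φ(E) ⊆ E₂ ⊆ …` (indexed from `0`) of vector sublattices of `G`. -/
def dChain (D : Set HFun) (φ : VLHom E G) : ℕ → VectorSublattice G
  | 0 => φ.range
  | n + 1 => dStep D (dChain D φ n)

theorem dChain_subset_succ (D : Set HFun) (φ : VLHom E G) (n : ℕ) :
    (dChain D φ n : Set G) ⊆ dChain D φ (n + 1) :=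
  fun _ hx => VectorSublattice.subset_closure _ (Or.inl hx)

/-- The space `E^D`: the union of the chain `dChain D φ`.  It is used when `(G, φ)` is a uniform
completion of `E`. -/
def dHull (D : Set HFun) (φ : VLHom E G) : VectorSublattice G :=
  VectorSublattice.iUnionOfMonotone (dChain D φ) (dChain_subset_succ D φ)

/-- The natural embedding of `E` into `E^D`. -/
def toDHull (D : Set HFun) (φ : VLHom E G) : VLHom E (dHull D φ) :=
  φ.codRestrict (dHull D φ) fun x => ⟨0, ⟨x, rfl⟩⟩

end Completions

end FunctionalCompletion

set_option linter.unusedSectionVars false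

namespace FunctionalCompletion

/-! ### Homomorphisms and generated sublattices -/

section Homomorphisms

variable {E F G : Type*} [AddCommGroup E] [Lattice E] [Module ℝ E]
  [AddCommGroup F] [Lattice F] [Module ℝ F] [AddCommGroup G] [Lattice G] [Module ℝ G]

/-! An Archimedean vector lattice may have no nonzero real homomorphism, but on countably generated
sublattices there are enough of them. A Rasiowa–Sikorski argument
(`IsArchimedean.exists_sublattice_hom`) gives, for countable `A` and `x > 0`, a homomorphism that is
defined on a sublattice containing `A` and `x` and takes `x` to 1. Hence real homomorphisms
determine the order of a countably generated sublattice, and `h(a) = b` determines `b`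
(`CalcEq.unique`).

For the uniform completion, `E` acts by evaluation on functions that are homomorphisms on countably
generated sublattices. Germs of such evaluations along a filter with countable intersections form an
Archimedean, uniformly complete space containing `E`, and the relatively uniform closure of `E` in
it is the completion. Its universal property depends only on `RUGenerates`: a maximal graph in `U ×
F` is closed under relatively uniform limits, so its domain is all of `U`
(`RUGenerates.exists_extension`). Conversely, every uniform completion satisfies `RUGenerates`.

A continuous positively homogeneous `h` is approximated by lattice-linear functions, by
Stone–Weierstrass on the unit sphere. Uniform completeness turns the approximants into an element
`h(a)` (`UniformlyComplete.exists_calcEq`), so `E^D` is `D`-complete.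

To extend `T : E → F` with `F` merely `D`-complete, embed `F` in its own uniform completion `V` and
extend to `S : U → V`. Homomorphisms preserve the calculus and its values are unique, so by
induction along the chain `S` maps `E^D` into `F`. The same two facts show that the extension is
unique, and uniqueness of the `D`-completion is then formal. -/

instance VLHom.instLinearMapClass : LinearMapClass (VLHom E F) ℝ E F where
  map_add T := T.map_add'
  map_smulₛₗ T := T.map_smul'

instance VLHom.instLatticeHomClass : LatticeHomClass (VLHom E F) E F where
  map_sup T := T.map_sup'
  map_inf T := T.map_inf'

theorem VLHom.map_abs (T : VLHom E F) (x : E) : T |x| = |T x| := by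
  simp only [abs, map_sup, map_neg]

theorem VLHom.ext {S T : VLHom E F} (h : ∀ x, S x = T x) : S = T :=
  DFunLike.ext _ _ h

/-- Composition of vector lattice homomorphisms. -/
def VLHom.comp (S : VLHom F G) (T : VLHom E F) : VLHom E G where
  toLinearMap := S.toLinearMap.comp T.toLinearMap
  map_sup' x y := show S (T (x ⊔ y)) = S (T x) ⊔ S (T y) by rw [map_sup, map_sup]
  map_inf' x y := show S (T (x ⊓ y)) = S (T x) ⊓ S (T y) by rw [map_inf, map_inf]

@[simp]
theorem VLHom.comp_apply (S : VLHom F G) (T : VLHom E F) (x : E) : S.comp T x = S (T x) := rfl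

/-- The identity as a vector lattice homomorphism. -/
def VLHom.id : VLHom E E where
  toLinearMap := LinearMap.id
  map_sup' _ _ := rfl
  map_inf' _ _ := rfl

/-- The inverse of a bijective vector lattice homomorphism. -/
noncomputable def VLHom.inverse (T : VLHom E F) (hT : Function.Bijective T) : VLHom F E where
  toLinearMap := (LinearEquiv.ofBijective T.toLinearMap hT).symm
  map_sup' x y := hT.1 <| by
    have h := (LinearEquiv.ofBijective T.toLinearMap hT).apply_symm_apply
    exact (h (x ⊔ y)).trans ((congrArg₂ (· ⊔ ·) (h x) (h y)).symm.trans (map_sup T _ _).symm)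
  map_inf' x y := hT.1 <| by
    have h := (LinearEquiv.ofBijective T.toLinearMap hT).apply_symm_apply
    exact (h (x ⊓ y)).trans ((congrArg₂ (· ⊓ ·) (h x) (h y)).symm.trans (map_inf T _ _).symm)

theorem VLHom.apply_inverse (T : VLHom E F) (hT : Function.Bijective T) (y : F) :
    T (T.inverse hT y) = y :=
  (LinearEquiv.ofBijective T.toLinearMap hT).apply_symm_apply y

theorem VLHom.inverse_apply (T : VLHom E F) (hT : Function.Bijective T) (x : E) :
    T.inverse hT (T x) = x :=
  hT.1 (T.apply_inverse hT _)

namespace VectorSublattice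

/-- The inclusion of a vector sublattice. -/
def subtype (L : VectorSublattice E) : VLHom L E where
  toLinearMap := L.toSubmodule.subtype
  map_sup' _ _ := rfl
  map_inf' _ _ := rfl

/-- The inclusion of a vector sublattice in a larger one. -/
def inclusion {L M : VectorSublattice E} (h : (L : Set E) ⊆ M) : VLHom L M :=
  L.subtype.codRestrict M fun x => h x.2

theorem closure_le {A : Set E} {L : VectorSublattice E} (h : A ⊆ L) :
    (closure A : Set E) ⊆ L := fun _ hx => hx L h

theorem closure_mono {A B : Set E} (h : A ⊆ B) : (closure A : Set E) ⊆ closure B :=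
  closure_le (h.trans (subset_closure B))

theorem sup_mem (L : VectorSublattice E) {x y : E} (hx : x ∈ L) (hy : y ∈ L) : x ⊔ y ∈ L :=
  L.sup_mem' x y hx hy

theorem inf_mem (L : VectorSublattice E) {x y : E} (hx : x ∈ L) (hy : y ∈ L) : x ⊓ y ∈ L :=
  L.inf_mem' x y hx hy

theorem smul_mem (L : VectorSublattice E) (c : ℝ) {x : E} (hx : x ∈ L) : c • x ∈ L :=
  SMulMemClass.smul_mem c hx

theorem abs_mem (L : VectorSublattice E) {x : E} (hx : x ∈ L) : |x| ∈ L :=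
  L.sup_mem hx (neg_mem hx)

/-- The preimage of a vector sublattice under a vector lattice homomorphism. -/
def comap (T : VLHom E F) (L : VectorSublattice F) : VectorSublattice E where
  toSubmodule := L.toSubmodule.comap T.toLinearMap
  sup_mem' x y hx hy := show T (x ⊔ y) ∈ L by rw [map_sup]; exact L.sup_mem hx hy
  inf_mem' x y hx hy := show T (x ⊓ y) ∈ L by rw [map_inf]; exact L.inf_mem hx hy

/-- The image of a vector sublattice under a vector lattice homomorphism. -/
def map (T : VLHom E F) (L : VectorSublattice E) : VectorSublattice F :=
  (T.comp L.subtype).range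

theorem mem_map {T : VLHom E F} {L : VectorSublattice E} {y : F} :
    y ∈ map T L ↔ ∃ x ∈ L, T x = y :=
  ⟨fun ⟨x, hx⟩ => ⟨x, x.2, hx⟩, fun ⟨x, hx, h⟩ => ⟨⟨x, hx⟩, h⟩⟩

/-- The vector sublattice on which two vector lattice homomorphisms agree. -/
def eqLocus (S T : VLHom E F) : VectorSublattice E where
  toSubmodule := LinearMap.eqLocus S.toLinearMap T.toLinearMap
  sup_mem' x y hx hy := show S (x ⊔ y) = T (x ⊔ y) by
    rw [map_sup, map_sup, show S x = T x from hx, show S y = T y from hy]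
  inf_mem' x y hx hy := show S (x ⊓ y) = T (x ⊓ y) by
    rw [map_inf, map_inf, show S x = T x from hx, show S y = T y from hy]

end VectorSublattice

end Homomorphisms

/-! ### Real homomorphisms on countably generated sublattices -/

section Archimedean

variable {E : Type*} [AddCommGroup E] [Lattice E] [Module ℝ E] [IsOrderedAddMonoid E]
  [IsOrderedModule ℝ E]

theorem IsArchimedean.le_zero_of_forall_le_smul (hE : IsArchimedean E) {x p : E}
    (h : ∀ ε : ℝ, 0 < ε → x ≤ ε • p) : x ≤ 0 := by
  -- The bound is `|p|` rather than `p` because the case `n = 0` requires it to be nonnegative.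
  refine hE x |p| fun n => ?_
  rcases Nat.eq_zero_or_pos n with rfl | hn
  · simp
  · have hn' : (0 : ℝ) < n := by exact_mod_cast hn
    calc n • x = (n : ℝ) • x := (Nat.cast_smul_eq_nsmul ℝ n x).symm
      _ ≤ (n : ℝ) • ((n : ℝ)⁻¹ • p) := smul_le_smul_of_nonneg_left (h _ (inv_pos.2 hn')) hn'.le
      _ = p := smul_inv_smul₀ hn'.ne' p
      _ ≤ |p| := le_abs_self p

theorem IsArchimedean.le_of_forall_le_add_smul (hE : IsArchimedean E) {x y p : E}
    (h : ∀ ε : ℝ, 0 < ε → x ≤ y + ε • p) : x ≤ y :=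
  sub_nonpos.1 <| hE.le_zero_of_forall_le_smul fun ε hε => sub_le_iff_le_add'.2 (h ε hε)

theorem IsArchimedean.of_injective {F : Type*} [AddCommGroup F] [Lattice F] [Module ℝ F]
    (hE : IsArchimedean E) (T : VLHom F E) (hT : Function.Injective T) : IsArchimedean F := by
  have hle : ∀ {x y : F}, T x ≤ T y → x ≤ y := fun {x y} h => by
    rw [← sup_eq_right] at h ⊢
    exact hT (by rw [map_sup, h])
  intro x y h
  refine hle ?_
  rw [map_zero]
  refine hE (T x) (T y) fun n => ?_
  rw [← map_nsmul]
  exact OrderHomClass.mono T (h n)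

theorem inf_add_le_add_inf {u b c : E} (hu : 0 ≤ u) (hb : 0 ≤ b) (hc : 0 ≤ c) :
    u ⊓ (b + c) ≤ u ⊓ b + u ⊓ c := by
  rw [add_inf, inf_add, inf_add]
  refine le_inf (le_inf ?_ ?_) (le_inf ?_ inf_le_right)
  · exact inf_le_left.trans (le_add_of_nonneg_left hu)
  · exact inf_le_left.trans (le_add_of_nonneg_left hb)
  · exact inf_le_left.trans (le_add_of_nonneg_right hc)

/-- A cone of elements that are to become nonpositive under a real homomorphism sending the
reference element `x` to `1`. -/
structure NonposCone (x : E) where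
  carrier : Set E
  add_mem : ∀ {b c}, b ∈ carrier → c ∈ carrier → b + c ∈ carrier
  smul_mem : ∀ {r : ℝ} {b}, 0 ≤ r → b ∈ carrier → r • b ∈ carrier
  mem_of_le : ∀ {b c}, b ≤ c → c ∈ carrier → b ∈ carrier
  sup_mem : ∀ {b c}, b ∈ carrier → c ∈ carrier → b ⊔ c ∈ carrier
  zero_mem : (0 : E) ∈ carrier
  smul_notMem : ∀ r : ℝ, 0 < r → r • x ∉ carrier

namespace NonposCone

variable {x : E} (N : NonposCone x)

/-- `a` has value `r` relative to the unit `x` and the cone `N`. -/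
def Val (a : E) (r : ℝ) : Prop :=
  ∀ ε : ℝ, 0 < ε → a - (r + ε) • x ∈ N.carrier ∧ (r - ε) • x - a ∈ N.carrier

variable {N}

/-- If `s < r`, adding the lower estimate for `a` to the upper one for `b` puts a positive multiple
of `x` below an element of the cone, which `smul_notMem` forbids. This makes values unique. -/
theorem Val.le {a b : E} {r s : ℝ} (ha : N.Val a r) (hb : N.Val b s) (hab : a ≤ b) : r ≤ s := by
  by_contra! h
  have h1 := N.add_mem (ha ((r - s) / 4) (by linarith)).2 (hb ((r - s) / 4) (by linarith)).1
  refine N.smul_notMem ((r - s) / 2) (by linarith) (N.mem_of_le ?_ h1)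
  have : (r - (r - s) / 4) • x - a + (b - (s + (r - s) / 4) • x) =
      ((r - s) / 2) • x + (b - a) := by module
  rw [this]
  exact le_add_of_nonneg_right (sub_nonneg.2 hab)

theorem Val.eq {a : E} {r s : ℝ} (ha : N.Val a r) (hb : N.Val a s) : r = s :=
  (ha.le hb le_rfl).antisymm (hb.le ha le_rfl)

theorem Val.add {a b : E} {r s : ℝ} (ha : N.Val a r) (hb : N.Val b s) :
    N.Val (a + b) (r + s) := by
  intro ε hε
  constructor
  · have := N.add_mem (ha (ε / 2) (by linarith)).1 (hb (ε / 2) (by linarith)).1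
    convert this using 1
    module
  · have := N.add_mem (ha (ε / 2) (by linarith)).2 (hb (ε / 2) (by linarith)).2
    convert this using 1
    module

theorem Val.neg {a : E} {r : ℝ} (ha : N.Val a r) : N.Val (-a) (-r) := by
  intro ε hε
  constructor
  · convert (ha ε hε).2 using 1
    module
  · convert (ha ε hε).1 using 1
    module

theorem val_zero (hx : 0 ≤ x) : N.Val 0 0 := by
  intro ε hε
  have := smul_nonneg hε.le hx
  constructor <;> refine N.mem_of_le ?_ N.zero_mem <;> simpa

theorem Val.smul_of_pos {a : E} {r c : ℝ} (hc : 0 < c) (ha : N.Val a r) :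
    N.Val (c • a) (c * r) := by
  intro ε hε
  have h := ha (ε / c) (div_pos hε hc)
  have hcε : ε = c * (ε / c) := by field_simp
  constructor
  · convert N.smul_mem hc.le h.1 using 1
    rw [smul_sub, smul_smul, mul_add, ← hcε]
  · convert N.smul_mem hc.le h.2 using 1
    rw [smul_sub, smul_smul, mul_sub, ← hcε]

theorem Val.smul {a : E} {r : ℝ} (hx : 0 ≤ x) (c : ℝ) (ha : N.Val a r) :
    N.Val (c • a) (c * r) := by
  rcases lt_trichotomy c 0 with hc | rfl | hc
  · simpa using (ha.smul_of_pos (neg_pos.2 hc)).neg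
  · simpa using val_zero hx
  · exact ha.smul_of_pos hc

theorem Val.sup {a b : E} {r s : ℝ} (hx : 0 ≤ x) (ha : N.Val a r) (hb : N.Val b s) :
    N.Val (a ⊔ b) (r ⊔ s) := by
  intro ε hε
  constructor
  · refine N.mem_of_le ?_ (N.sup_mem (ha ε hε).1 (hb ε hε).1)
    rw [sup_sub]
    refine sup_le_sup (sub_le_sub_left (smul_le_smul_of_nonneg_right ?_ hx) _)
      (sub_le_sub_left (smul_le_smul_of_nonneg_right ?_ hx) _)
    · linarith [le_max_left r s]
    · linarith [le_max_right r s]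
  · rcases le_total r s with h | h
    · rw [sup_eq_right.2 h]
      exact N.mem_of_le (sub_le_sub_left le_sup_right _) (hb ε hε).2
    · rw [sup_eq_left.2 h]
      exact N.mem_of_le (sub_le_sub_left le_sup_left _) (ha ε hε).2

theorem Val.inf {a b : E} {r s : ℝ} (hx : 0 ≤ x) (ha : N.Val a r) (hb : N.Val b s) :
    N.Val (a ⊓ b) (r ⊓ s) := by
  simpa [neg_sup] using (ha.neg.sup hx hb.neg).neg

theorem val_self (hx : 0 ≤ x) : N.Val x 1 := by
  intro ε hε
  have hm : -(ε • x) ∈ N.carrier :=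
    N.mem_of_le (neg_nonpos.2 (smul_nonneg hε.le hx)) N.zero_mem
  constructor
  · convert hm using 1
    module
  · convert hm using 1
    module

/-- An element that is bounded by multiples of `x` and comparable with all rational multiples
of `x`, relative to the cone `N`, has a value. -/
theorem exists_val (hx : 0 ≤ x) {a : E} (hbdd : ∃ m : ℝ, |a| - m • x ∈ N.carrier)
    (hcmp : ∀ c : ℚ, (c : ℝ) • x - a ∈ N.carrier ∨ a - (c : ℝ) • x ∈ N.carrier) :
    ∃ r, N.Val a r := by
  obtain ⟨m, hm⟩ := hbdd
  -- The value is the supremum of this lower cut. A rational just above the supremum is not in the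
  -- cut, so comparability gives the upper estimate.
  set S : Set ℝ := {c | c • x - a ∈ N.carrier} with hS
  have hne : S.Nonempty := by
    refine ⟨-m, N.mem_of_le ?_ hm⟩
    rw [neg_smul, sub_eq_add_neg, sub_eq_add_neg, add_comm]
    exact add_le_add_left (neg_le_abs a) _
  have hb : BddAbove S := by
    refine ⟨m, fun c hc => ?_⟩
    by_contra! h
    refine N.smul_notMem (c - m) (sub_pos.2 h) (N.mem_of_le ?_ (N.add_mem hc hm))
    have : c • x - a + (|a| - m • x) = (c - m) • x + (|a| - a) := by module
    rw [this]
    exact le_add_of_nonneg_right (sub_nonneg.2 (le_abs_self a))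
  refine ⟨sSup S, fun ε hε => ⟨?_, ?_⟩⟩
  · obtain ⟨q, hq1, hq2⟩ := exists_rat_btwn (show sSup S < sSup S + ε by linarith)
    rcases hcmp q with h | h
    · exact absurd (le_csSup hb h) (not_le.2 hq1)
    · exact N.mem_of_le (sub_le_sub_left (smul_le_smul_of_nonneg_right hq2.le hx) _) h
  · obtain ⟨c, hc, hlt⟩ := exists_lt_of_lt_csSup hne (show sSup S - ε < sSup S by linarith)
    exact N.mem_of_le (sub_le_sub_right (smul_le_smul_of_nonneg_right hlt.le hx) _) hc

variable (N) in
/-- The vector sublattice of all elements that have a value. -/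
def valued (hx : 0 ≤ x) : VectorSublattice E where
  carrier := {a | ∃ r, N.Val a r}
  add_mem' := fun ⟨_, ha⟩ ⟨_, hb⟩ => ⟨_, ha.add hb⟩
  zero_mem' := ⟨0, val_zero hx⟩
  smul_mem' c _ := fun ⟨_, ha⟩ => ⟨_, ha.smul hx c⟩
  sup_mem' _ _ := fun ⟨_, ha⟩ ⟨_, hb⟩ => ⟨_, ha.sup hx hb⟩
  inf_mem' _ _ := fun ⟨_, ha⟩ ⟨_, hb⟩ => ⟨_, ha.inf hx hb⟩

variable (N) in
/-- The real homomorphism that assigns to each valued element its value. -/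
noncomputable def valHom (hx : 0 ≤ x) : VLHom (N.valued hx) ℝ where
  toFun a := a.2.choose
  map_add' a b := (a + b).2.choose_spec.eq (a.2.choose_spec.add b.2.choose_spec)
  map_smul' c a := (c • a).2.choose_spec.eq (a.2.choose_spec.smul hx c)
  map_sup' a b := (a ⊔ b).2.choose_spec.eq (a.2.choose_spec.sup hx b.2.choose_spec)
  map_inf' a b := (a ⊓ b).2.choose_spec.eq (a.2.choose_spec.inf hx b.2.choose_spec)

theorem valHom_eq (hx : 0 ≤ x) (a : N.valued hx) {r : ℝ} (h : N.Val a r) :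
    N.valHom hx a = r :=
  a.2.choose_spec.eq h

end NonposCone

theorem nsmul_inf_eq_zero {u b : E} (hu : 0 ≤ u) (hb : 0 ≤ b) (h : u ⊓ b = 0) (n : ℕ) :
    (n • u) ⊓ b = 0 := by
  induction n with
  | zero => simpa using hb
  | succ n ih =>
    refine le_antisymm ?_ (le_inf (nsmul_nonneg hu _) hb)
    rw [succ_nsmul, inf_comm]
    refine (inf_add_le_add_inf hb (nsmul_nonneg hu _) hu).trans ?_
    rw [inf_comm, ih, inf_comm, h, add_zero]

/-- A filter base of positive elements below `x` determines the cone of all elements whose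
positive part is disjoint from some member of the base. -/
def NonposCone.ofDirected {x : E} (I : Set E) (hne : I.Nonempty) (hpos : ∀ u ∈ I, 0 < u)
    (hle : ∀ u ∈ I, u ≤ x) (hdir : ∀ u ∈ I, ∀ v ∈ I, ∃ w ∈ I, w ≤ u ∧ w ≤ v) :
    NonposCone x where
  carrier := {b | ∃ u ∈ I, u ⊓ b⁺ = 0}
  add_mem := by
    rintro b c ⟨u, hu, hub⟩ ⟨v, hv, hvc⟩
    obtain ⟨w, hw, hwu, hwv⟩ := hdir u hu v hv
    have h0 := (hpos w hw).le
    refine ⟨w, hw, le_antisymm ?_ (le_inf h0 (posPart_nonneg _))⟩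
    have hbc : (b + c)⁺ ≤ b⁺ + c⁺ :=
      sup_le (add_le_add (le_posPart b) (le_posPart c))
        (add_nonneg (posPart_nonneg b) (posPart_nonneg c))
    calc w ⊓ (b + c)⁺ ≤ w ⊓ (b⁺ + c⁺) := inf_le_inf_left _ hbc
      _ ≤ w ⊓ b⁺ + w ⊓ c⁺ := inf_add_le_add_inf h0 (posPart_nonneg b) (posPart_nonneg c)
      _ ≤ u ⊓ b⁺ + v ⊓ c⁺ := add_le_add (inf_le_inf_right _ hwu) (inf_le_inf_right _ hwv)
      _ = 0 := by rw [hub, hvc, add_zero]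
  smul_mem := by
    rintro r b hr ⟨u, hu, hub⟩
    obtain ⟨n, hn⟩ := exists_nat_ge r
    refine ⟨u, hu, le_antisymm ?_ (le_inf (hpos u hu).le (posPart_nonneg _))⟩
    have h1 : (r • b)⁺ ≤ n • b⁺ := by
      refine sup_le ?_ (nsmul_nonneg (posPart_nonneg b) n)
      rw [← Nat.cast_smul_eq_nsmul ℝ]
      exact (smul_le_smul_of_nonneg_left (le_posPart b) hr).trans
        (smul_le_smul_of_nonneg_right hn (posPart_nonneg b))
    refine (inf_le_inf_left u h1).trans (le_of_eq ?_)
    rw [inf_comm]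
    exact nsmul_inf_eq_zero (posPart_nonneg b) (hpos u hu).le (by rw [inf_comm, hub]) n
  mem_of_le := by
    rintro b c hbc ⟨u, hu, huc⟩
    exact ⟨u, hu, le_antisymm ((inf_le_inf_left u (posPart_mono hbc)).trans huc.le)
      (le_inf (hpos u hu).le (posPart_nonneg _))⟩
  sup_mem := by
    rintro b c ⟨u, hu, hub⟩ ⟨v, hv, hvc⟩
    obtain ⟨w, hw, hwu, hwv⟩ := hdir u hu v hv
    have h0 := (hpos w hw).le
    refine ⟨w, hw, le_antisymm ?_ (le_inf h0 (posPart_nonneg _))⟩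
    have hbc : (b ⊔ c)⁺ ≤ b⁺ + c⁺ := by
      have hb := posPart_nonneg b
      have hc := posPart_nonneg c
      exact sup_le (sup_le ((le_posPart b).trans (le_add_of_nonneg_right hc))
        ((le_posPart c).trans (le_add_of_nonneg_left hb))) (add_nonneg hb hc)
    calc w ⊓ (b ⊔ c)⁺ ≤ w ⊓ (b⁺ + c⁺) := inf_le_inf_left _ hbc
      _ ≤ w ⊓ b⁺ + w ⊓ c⁺ := inf_add_le_add_inf h0 (posPart_nonneg b) (posPart_nonneg c)
      _ ≤ u ⊓ b⁺ + v ⊓ c⁺ := add_le_add (inf_le_inf_right _ hwu) (inf_le_inf_right _ hwv)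
      _ = 0 := by rw [hub, hvc, add_zero]
  zero_mem := by
    obtain ⟨u, hu⟩ := hne
    exact ⟨u, hu, by rw [posPart_zero]; exact inf_eq_right.2 (hpos u hu).le⟩
  smul_notMem := by
    rintro r hr ⟨u, hu, h⟩
    -- With `n * r ≥ 1`, the element `u ≤ x` lies below `n • r • x`, from which it is also disjoint;
    -- hence `u = 0`.
    obtain ⟨n, hn⟩ := exists_nat_ge r⁻¹
    have hx : 0 ≤ x := (hpos u hu).le.trans (hle u hu)
    have hrx : 0 ≤ r • x := smul_nonneg hr.le hx
    rw [posPart_of_nonneg hrx, inf_comm] at h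
    have h2 := nsmul_inf_eq_zero hrx (hpos u hu).le h n
    rw [← Nat.cast_smul_eq_nsmul ℝ, smul_smul, inf_eq_right.2] at h2
    · exact (hpos u hu).ne' h2
    · refine (hle u hu).trans ?_
      have : 1 ≤ n * r := by
        calc 1 = r⁻¹ * r := (inv_mul_cancel₀ hr.ne').symm
          _ ≤ n * r := mul_le_mul_of_nonneg_right hn hr.le
      simpa using smul_le_smul_of_nonneg_right this hx

/-- Density of the comparability conditions: if `u` itself is not disjoint from `b⁺`, then `u ⊓ b⁺`
is a smaller positive element disjoint from `b⁻`. -/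
theorem exists_inf_posPart_eq_zero_or {u : E} (hu : 0 < u) (b : E) :
    ∃ v ≤ u, 0 < v ∧ (v ⊓ b⁺ = 0 ∨ v ⊓ (-b)⁺ = 0) := by
  by_cases h : u ⊓ b⁺ = 0
  · exact ⟨u, le_rfl, hu, Or.inl h⟩
  · have h0 : 0 ≤ u ⊓ b⁺ := le_inf hu.le (posPart_nonneg b)
    refine ⟨u ⊓ b⁺, inf_le_left, lt_of_le_of_ne h0 (Ne.symm h), Or.inr ?_⟩
    refine le_antisymm ?_ (le_inf h0 (posPart_nonneg _))
    refine (inf_le_inf_right _ inf_le_right).trans (le_of_eq ?_)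
    rw [posPart_neg, posPart_inf_negPart_eq_zero]

/-- Density of the boundedness conditions, where the Archimedean property enters: if `u` were
disjoint from `(n • x - |a|)⁺` for all `n`, then `n • u ≤ |a|` for all `n`. -/
theorem IsArchimedean.exists_inf_posPart_abs_sub_eq_zero (hE : IsArchimedean E) {u x : E}
    (hu : 0 < u) (hux : u ≤ x) (a : E) :
    ∃ v ≤ u, 0 < v ∧ ∃ m : ℝ, v ⊓ (|a| - m • x)⁺ = 0 := by
  have key : ∃ n : ℕ, u ⊓ (n • x - |a|)⁺ ≠ 0 := by
    by_contra! h
    refine hu.not_ge (hE u |a| fun n => ?_)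
    have hnu : 0 ≤ n • u := nsmul_nonneg hu.le n
    have h1 : n • u ≤ (n • x - |a|)⁺ + |a| :=
      (nsmul_le_nsmul_right hux n).trans (sub_le_iff_le_add.1 (le_posPart _))
    calc n • u = n • u ⊓ ((n • x - |a|)⁺ + |a|) := (inf_eq_left.2 h1).symm
      _ ≤ n • u ⊓ (n • x - |a|)⁺ + n • u ⊓ |a| :=
        inf_add_le_add_inf hnu (posPart_nonneg _) (abs_nonneg a)
      _ ≤ 0 + |a| := add_le_add
        (nsmul_inf_eq_zero hu.le (posPart_nonneg _) (h n) n).le inf_le_right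
      _ = |a| := zero_add _
  obtain ⟨n, hn⟩ := key
  have h0 : 0 ≤ u ⊓ (n • x - |a|)⁺ := le_inf hu.le (posPart_nonneg _)
  refine ⟨_, inf_le_left, lt_of_le_of_ne h0 (Ne.symm hn), n, ?_⟩
  refine le_antisymm ?_ (le_inf h0 (posPart_nonneg _))
  refine (inf_le_inf_right _ inf_le_right).trans (le_of_eq ?_)
  rw [Nat.cast_smul_eq_nsmul, ← neg_sub (n • x), posPart_neg, posPart_inf_negPart_eq_zero]

/-- Countably many elements of an Archimedean vector lattice lie in a vector sublattice with a
real homomorphism that does not vanish at a prescribed positive element. -/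
theorem IsArchimedean.exists_sublattice_hom (hE : IsArchimedean E) {A : Set E}
    (hA : A.Countable) {x : E} (hx : 0 < x) :
    ∃ (L : VectorSublattice E) (hxL : x ∈ L) (ω : VLHom L ℝ), A ⊆ L ∧ ω ⟨x, hxL⟩ = 1 := by
  have := hA.to_subtype
  let := Encodable.ofCountable (A × Option ℚ)
  -- In the dual order, dense families of positive elements below `x` are cofinal and ideals are
  -- filter bases. There are only countably many conditions: one bound and all rational comparisons
  -- for each element of `A`.
  let P := {u : E // 0 < u ∧ u ≤ x}ᵒᵈ
  let S : A × Option ℚ → Set E := fun i => match i.2 with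
    | none => {u | ∃ m : ℝ, u ⊓ (|i.1.1| - m • x)⁺ = 0}
    | some c => {u | u ⊓ ((c : ℝ) • x - i.1.1)⁺ = 0 ∨ u ⊓ (i.1.1 - (c : ℝ) • x)⁺ = 0}
  have hS : ∀ i, ∀ u, 0 < u → u ≤ x → ∃ v ≤ u, 0 < v ∧ v ∈ S i := by
    rintro ⟨a, _ | c⟩ u hu hux
    · exact hE.exists_inf_posPart_abs_sub_eq_zero hu hux a.1
    · have h := exists_inf_posPart_eq_zero_or hu ((c : ℝ) • x - a.1)
      rw [neg_sub] at h
      exact h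
  let 𝒟 : A × Option ℚ → Order.Cofinal P := fun i =>
    { carrier := {u | (OrderDual.ofDual u).1 ∈ S i}
      isCofinal := fun u => by
        obtain ⟨v, hvu, hv, hvS⟩ := hS i u.1 u.2.1 u.2.2
        exact ⟨OrderDual.toDual ⟨v, hv, hvu.trans u.2.2⟩, hvS, hvu⟩ }
  let p : P := OrderDual.toDual ⟨x, hx, le_rfl⟩
  let J := Order.idealOfCofinals p 𝒟
  let I : Set E := {u | ∃ h : 0 < u ∧ u ≤ x, (OrderDual.toDual ⟨u, h⟩ : P) ∈ J}
  let N : NonposCone x := NonposCone.ofDirected I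
    ⟨x, ⟨hx, le_rfl⟩, Order.mem_idealOfCofinals p 𝒟⟩ (fun u hu => hu.1.1) (fun u hu => hu.1.2) <| by
      rintro u ⟨hu, huJ⟩ v ⟨hv, hvJ⟩
      obtain ⟨w, hw, h1, h2⟩ := J.directed _ huJ _ hvJ
      exact ⟨w.1, ⟨w.2, hw⟩, h1, h2⟩
  have hmeet : ∀ i, ∃ u ∈ I, u ∈ S i := fun i => by
    obtain ⟨u, hu, huJ⟩ := Order.cofinal_meets_idealOfCofinals p 𝒟 i
    exact ⟨u.1, ⟨u.2, huJ⟩, hu⟩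
  have hxv := N.val_self hx.le
  refine ⟨N.valued hx.le, ⟨1, hxv⟩, N.valHom hx.le, fun a ha => ?_, N.valHom_eq hx.le _ hxv⟩
  refine NonposCone.exists_val hx.le ?_ fun c => ?_
  · obtain ⟨u, hu, m, hm⟩ := hmeet (⟨a, ha⟩, none)
    exact ⟨m, u, hu, hm⟩
  · obtain ⟨u, hu, h⟩ := hmeet (⟨a, ha⟩, some c)
    exact h.imp (fun h => ⟨u, hu, h⟩) fun h => ⟨u, hu, h⟩

/-- Real homomorphisms determine the order of a countably generated vector sublattice. -/
theorem IsArchimedean.nonneg_of_forall_hom (hE : IsArchimedean E) {A : Set E}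
    (hA : A.Countable) {y : VectorSublattice.closure A}
    (h : ∀ ω : VLHom (VectorSublattice.closure A) ℝ, 0 ≤ ω y) : 0 ≤ y := by
  by_contra hy
  have hy' : 0 < (y : E)⁻ :=
    lt_of_le_of_ne (negPart_nonneg _) fun h0 => hy (negPart_eq_zero (a := (y : E)) |>.1 h0.symm)
  -- A homomorphism taking `y⁻` to 1 cannot be nonnegative at `y`.
  obtain ⟨L, hL, ω, hAL, hω⟩ := hE.exists_sublattice_hom hA hy'
  have hyL : (y : E) ∈ L := VectorSublattice.closure_le hAL y.2
  have h1 : 0 ≤ ω ⟨y, hyL⟩ := h (ω.comp (VectorSublattice.inclusion (VectorSublattice.closure_le hAL)))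
  have h2 : (⟨(y : E)⁻, hL⟩ : L) = (-⟨y, hyL⟩) ⊔ 0 := rfl
  rw [h2, map_sup, map_neg, map_zero, sup_eq_right.2 (neg_nonpos.2 h1)] at hω
  exact zero_ne_one hω

theorem IsArchimedean.le_of_forall_hom (hE : IsArchimedean E) {A : Set E}
    (hA : A.Countable) {y z : VectorSublattice.closure A}
    (h : ∀ ω : VLHom (VectorSublattice.closure A) ℝ, ω y ≤ ω z) : y ≤ z :=
  sub_nonneg.1 <| hE.nonneg_of_forall_hom hA fun ω => by
    rw [map_sub]
    exact sub_nonneg.2 (h ω)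

theorem IsArchimedean.eq_of_forall_hom (hE : IsArchimedean E) {A : Set E}
    (hA : A.Countable) {y z : VectorSublattice.closure A}
    (h : ∀ ω : VLHom (VectorSublattice.closure A) ℝ, ω y = ω z) : y = z :=
  le_antisymm (hE.le_of_forall_hom hA fun ω => (h ω).le)
    (hE.le_of_forall_hom hA fun ω => (h ω).ge)

end Archimedean

/-! ### Relatively uniform convergence -/

section RelativelyUniform

variable {E F : Type*} [AddCommGroup E] [Lattice E] [Module ℝ E] [IsOrderedAddMonoid E]
  [IsOrderedModule ℝ E] [AddCommGroup F] [Lattice F] [Module ℝ F] [IsOrderedAddMonoid F]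
  [IsOrderedModule ℝ F]

/-- Relatively uniform convergence with a given regulator. -/
def RUBy (p : E) (f : ℕ → E) (g : E) : Prop :=
  ∀ ε : ℝ, 0 < ε → ∃ N : ℕ, ∀ n, N ≤ n → |f n - g| ≤ ε • p

/-- The relatively uniform Cauchy property with a given regulator. -/
def RUCauchyBy (p : E) (f : ℕ → E) : Prop :=
  ∀ ε : ℝ, 0 < ε → ∃ N : ℕ, ∀ m n, N ≤ m → N ≤ n → |f m - f n| ≤ ε • p

theorem RUConverges.exists_ruBy {f : ℕ → E} {g : E} (h : RUConverges f g) :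
    ∃ p, RUBy p f g := by
  obtain ⟨p, -, hp⟩ := h
  exact ⟨p, fun ε hε => (hp ε hε).imp fun N hN n hn => (hN n hn).le⟩

theorem smul_lt_smul_right_of_pos {p : E} (hp : 0 < p) {ε δ : ℝ} (h : ε < δ) :
    ε • p < δ • p := by
  rw [← sub_pos, ← sub_smul]
  refine lt_of_le_of_ne (smul_nonneg (sub_pos.2 h).le hp.le) fun h0 => hp.ne' ?_
  exact (smul_eq_zero.1 h0.symm).resolve_left (sub_pos.2 h).ne'

/-- Halving `ε` recovers the strict inequality when `p > 0`. The non-strict `RUBy` also allows a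
zero regulator, so it passes to images under homomorphisms. -/
theorem RUBy.ruConverges {p : E} (hp : 0 < p) {f : ℕ → E} {g : E} (h : RUBy p f g) :
    RUConverges f g :=
  ⟨p, hp, fun ε hε => (h (ε / 2) (half_pos hε)).imp fun _ hN n hn =>
    (hN n hn).trans_lt (smul_lt_smul_right_of_pos hp (half_lt_self hε))⟩

theorem RUCauchy.exists_ruCauchyBy {f : ℕ → E} (h : RUCauchy f) :
    ∃ p, 0 < p ∧ RUCauchyBy p f := by
  obtain ⟨p, hp, h⟩ := h
  exact ⟨p, hp, fun ε hε => (h ε hε).imp fun N hN m n hm hn => (hN m n hm hn).le⟩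

theorem RUCauchyBy.ruCauchy {p : E} (hp : 0 < p) {f : ℕ → E} (h : RUCauchyBy p f) :
    RUCauchy f :=
  ⟨p, hp, fun ε hε => (h (ε / 2) (half_pos hε)).imp fun _ hN m n hm hn =>
    (hN m n hm hn).trans_lt (smul_lt_smul_right_of_pos hp (half_lt_self hε))⟩

theorem RUBy.const (g : E) : RUBy 0 (fun _ => g) g := fun ε _ => ⟨0, fun n _ => by simp⟩

theorem abs_smul_le (c : ℝ) (x : E) : |c • x| ≤ |c| • |x| := by
  refine abs_le'.2 ⟨?_, ?_⟩
  · rcases le_total 0 c with hc | hc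
    · rw [abs_of_nonneg hc]
      exact smul_le_smul_of_nonneg_left (le_abs_self x) hc
    · rw [abs_of_nonpos hc, ← neg_smul_neg c x]
      exact smul_le_smul_of_nonneg_left (neg_le_abs x) (neg_nonneg.2 hc)
  · rcases le_total 0 c with hc | hc
    · rw [abs_of_nonneg hc, ← smul_neg]
      exact smul_le_smul_of_nonneg_left (neg_le_abs x) hc
    · rw [abs_of_nonpos hc, ← neg_smul]
      exact smul_le_smul_of_nonneg_left (le_abs_self x) (neg_nonneg.2 hc)

theorem abs_sub_le_abs_sub_add (a b c : E) : |a - c| ≤ |a - b| + |b - c| := by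
  simpa only [sub_add_sub_cancel] using abs_add_le (a - b) (b - c)

theorem eq_zero_of_abs_le_zero {x : E} (h : |x| ≤ 0) : x = 0 :=
  le_antisymm ((le_abs_self x).trans h) (neg_nonpos.1 ((neg_le_abs x).trans h))

theorem RUBy.of_abs_le_add {p q : E} {f f' h : ℕ → E} {g g' k : E} (hf : RUBy p f g)
    (hf' : RUBy q f' g') (H : ∀ n, |h n - k| ≤ |f n - g| + |f' n - g'|) :
    RUBy (p + q) h k := by
  intro ε hε
  obtain ⟨N, hN⟩ := hf ε hε
  obtain ⟨M, hM⟩ := hf' ε hε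
  refine ⟨max N M, fun n hn => (H n).trans ?_⟩
  rw [smul_add]
  exact add_le_add (hN n (le_of_max_le_left hn)) (hM n (le_of_max_le_right hn))

theorem RUBy.add {p q : E} {f f' : ℕ → E} {g g' : E} (hf : RUBy p f g) (hf' : RUBy q f' g') :
    RUBy (p + q) (fun n => f n + f' n) (g + g') :=
  hf.of_abs_le_add hf' fun n => by
    rw [add_sub_add_comm]
    exact abs_add_le _ _

theorem RUBy.sup {p q : E} {f f' : ℕ → E} {g g' : E} (hf : RUBy p f g) (hf' : RUBy q f' g') :
    RUBy (p + q) (fun n => f n ⊔ f' n) (g ⊔ g') :=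
  hf.of_abs_le_add hf' fun n => by
    have h1 := abs_sup_sub_sup_le_abs (f n) g (f' n)
    have h2 := abs_sup_sub_sup_le_abs (f' n) g' g
    rw [sup_comm _ g, sup_comm _ g] at h2
    calc _ = |(f n ⊔ f' n - g ⊔ f' n) + (g ⊔ f' n - g ⊔ g')| := by rw [sub_add_sub_cancel]
      _ ≤ _ := (abs_add_le _ _).trans (add_le_add h1 h2)

theorem RUBy.inf {p q : E} {f f' : ℕ → E} {g g' : E} (hf : RUBy p f g) (hf' : RUBy q f' g') :
    RUBy (p + q) (fun n => f n ⊓ f' n) (g ⊓ g') :=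
  hf.of_abs_le_add hf' fun n => by
    have h1 := abs_inf_sub_inf_le_abs (f n) g (f' n)
    have h2 := abs_inf_sub_inf_le_abs (f' n) g' g
    rw [inf_comm _ g, inf_comm _ g] at h2
    calc _ = |(f n ⊓ f' n - g ⊓ f' n) + (g ⊓ f' n - g ⊓ g')| := by rw [sub_add_sub_cancel]
      _ ≤ _ := (abs_add_le _ _).trans (add_le_add h1 h2)

theorem RUBy.smul {p : E} {f : ℕ → E} {g : E} (c : ℝ) (hf : RUBy p f g) :
    RUBy (|c| • p) (fun n => c • f n) (c • g) := fun ε hε =>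
  (hf ε hε).imp fun N hN n hn => by
    rw [← smul_sub, smul_comm]
    exact (abs_smul_le _ _).trans (smul_le_smul_of_nonneg_left (hN n hn) (abs_nonneg c))

theorem RUBy.map {p : E} {f : ℕ → E} {g : E} (T : VLHom E F) (hf : RUBy p f g) :
    RUBy (T p) (fun n => T (f n)) (T g) := fun ε hε =>
  (hf ε hε).imp fun N hN n hn => by
    rw [← map_sub, ← T.map_abs, ← map_smul]
    exact OrderHomClass.mono T (hN n hn)

theorem IsArchimedean.eq_of_ruBy (hE : IsArchimedean E) {p q : E} {f : ℕ → E} {g g' : E}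
    (h : RUBy p f g) (h' : RUBy q f g') : g = g' := by
  have hc : RUBy (p + q) (fun _ => g - g') 0 := h.of_abs_le_add h' fun n => by
    rw [sub_zero, abs_sub_comm (f n) g]
    exact abs_sub_le_abs_sub_add g (f n) g'
  refine sub_eq_zero.1 (eq_zero_of_abs_le_zero (hE.le_zero_of_forall_le_smul (p := p + q) fun ε hε => ?_))
  obtain ⟨N, hN⟩ := hc ε hε
  simpa using hN N le_rfl

/-- The limit of a relatively uniformly Cauchy sequence is attained with the regulator of the
Cauchy property. -/
theorem RUCauchyBy.ruBy (hE : IsArchimedean E) {p q : E} {f : ℕ → E} {g : E}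
    (hf : RUCauchyBy p f) (hg : RUBy q f g) : RUBy p f g := by
  intro ε hε
  obtain ⟨N, hN⟩ := hf ε hε
  -- Comparison with a far term leaves an error `δ • q` with `δ` arbitrary, which the Archimedean
  -- property removes.
  refine ⟨N, fun n hn => hE.le_of_forall_le_add_smul (p := q) fun δ hδ => ?_⟩
  obtain ⟨M, hM⟩ := hg δ hδ
  exact (abs_sub_le_abs_sub_add (f n) (f (max N M)) g).trans
    (add_le_add (hN n _ hn (le_max_left N M)) (hM _ (le_max_right N M)))

theorem RUCauchyBy.regulator_nonneg {p : E} {f : ℕ → E} (hf : RUCauchyBy p f) : 0 ≤ p := by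
  obtain ⟨N, hN⟩ := hf 1 one_pos
  simpa using hN N N le_rfl le_rfl

theorem UniformlyComplete.exists_ruBy (hE : IsArchimedean E) (hc : UniformlyComplete E) {p : E}
    {f : ℕ → E} (hf : RUCauchyBy p f) : ∃ g, RUBy p f g := by
  -- With regulator 0 the sequence is eventually constant; `UniformlyComplete` speaks only of
  -- positive regulators.
  rcases hf.regulator_nonneg.eq_or_lt with rfl | hp
  · obtain ⟨N, hN⟩ := hf 1 one_pos
    exact ⟨f N, fun ε _ => ⟨N, fun n hn => by simpa using hN n N hn le_rfl⟩⟩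
  · obtain ⟨g, hg⟩ := hc f (hf.ruCauchy hp)
    obtain ⟨q, hq⟩ := hg.exists_ruBy
    exact ⟨g, hf.ruBy hE hq⟩

namespace VectorSublattice

/-- Closedness under relatively uniform limits whose regulator lies in the sublattice. -/
def RUClosed (L : VectorSublattice E) : Prop :=
  ∀ (f : ℕ → E) (p g : E), (∀ n, f n ∈ L) → p ∈ L → RUBy p f g → g ∈ L

/-- The smallest relatively uniformly closed vector sublattice that contains a given set. -/
def ruClosure (A : Set E) : VectorSublattice E where
  carrier := {x | ∀ L : VectorSublattice E, L.RUClosed → A ⊆ L → x ∈ L}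
  add_mem' hx hy L hc hL := add_mem (hx L hc hL) (hy L hc hL)
  zero_mem' L _ _ := zero_mem L
  smul_mem' c _ hx L hc hL := L.smul_mem c (hx L hc hL)
  sup_mem' _ _ hx hy L hc hL := L.sup_mem (hx L hc hL) (hy L hc hL)
  inf_mem' _ _ hx hy L hc hL := L.inf_mem (hx L hc hL) (hy L hc hL)

theorem subset_ruClosure (A : Set E) : A ⊆ ruClosure A := fun _ hx _ _ hL => hL hx

theorem ruClosed_ruClosure (A : Set E) : (ruClosure A).RUClosed :=
  fun f p g hf hp h L hc hL => hc f p g (fun n => hf n L hc hL) (hp L hc hL) h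

theorem RUClosed.map_subtype {L : VectorSublattice E} (hL : L.RUClosed)
    {M : VectorSublattice L} (hM : M.RUClosed) : (map L.subtype M).RUClosed := by
  intro f p g hf hp h
  choose f' hf' hff using fun n => mem_map.1 (hf n)
  obtain ⟨p', hp', rfl⟩ := mem_map.1 hp
  obtain rfl : (fun n => L.subtype (f' n)) = f := funext hff
  have hg : g ∈ L := hL _ _ g (fun n => (f' n).2) p'.2 h
  exact mem_map.2 ⟨⟨g, hg⟩, hM f' p' ⟨g, hg⟩ hf' hp' h, rfl⟩

/-- The limit in `E` is attained with the Cauchy regulator, which already lies in `L`, so closedness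
applies. -/
theorem RUClosed.uniformlyComplete {L : VectorSublattice E} (hL : L.RUClosed)
    (hE : IsArchimedean E) (hc : UniformlyComplete E) : UniformlyComplete L := by
  intro f hf
  obtain ⟨p, hp, hf⟩ := hf.exists_ruCauchyBy
  obtain ⟨g, hg⟩ := hc.exists_ruBy hE (p := (p : E)) (f := fun n => (f n : E)) hf
  have hgL : g ∈ L := hL _ _ g (fun n => (f n).2) p.2 hg
  exact ⟨⟨g, hgL⟩, RUBy.ruConverges hp (g := ⟨g, hgL⟩) hg⟩

theorem isArchimedean (L : VectorSublattice E) (hE : IsArchimedean E) : IsArchimedean L :=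
  hE.of_injective L.subtype Subtype.coe_injective

theorem ruClosed_eqLocus (hF : IsArchimedean F) (S T : VLHom E F) : (eqLocus S T).RUClosed :=
  fun f p g hf _ h => hF.eq_of_ruBy (h.map S) (by
    have := h.map T
    rwa [show (fun n => T (f n)) = fun n => S (f n) from funext fun n => (hf n).symm] at this)

/-- The relatively uniform limits of sequences in a vector sublattice. -/
def ruStep (L : VectorSublattice E) : VectorSublattice E where
  carrier := {g | ∃ (f : ℕ → E) (p : E), (∀ n, f n ∈ L) ∧ p ∈ L ∧ RUBy p f g}
  add_mem' := fun ⟨_, _, hf, hp, h⟩ ⟨_, _, hf', hp', h'⟩ =>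
    ⟨_, _, fun n => add_mem (hf n) (hf' n), add_mem hp hp', h.add h'⟩
  zero_mem' := ⟨_, _, fun _ => zero_mem L, zero_mem L, RUBy.const 0⟩
  smul_mem' := fun c _ ⟨_, _, hf, hp, h⟩ =>
    ⟨_, _, fun n => L.smul_mem c (hf n), L.smul_mem _ hp, h.smul c⟩
  sup_mem' := fun _ _ ⟨_, _, hf, hp, h⟩ ⟨_, _, hf', hp', h'⟩ =>
    ⟨_, _, fun n => L.sup_mem (hf n) (hf' n), add_mem hp hp', h.sup h'⟩
  inf_mem' := fun _ _ ⟨_, _, hf, hp, h⟩ ⟨_, _, hf', hp', h'⟩ =>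
    ⟨_, _, fun n => L.inf_mem (hf n) (hf' n), add_mem hp hp', h.inf h'⟩

theorem subset_ruStep (L : VectorSublattice E) : (L : Set E) ⊆ ruStep L :=
  fun g hg => ⟨fun _ => g, 0, fun _ => hg, zero_mem L, RUBy.const g⟩

/-- The union of a nonempty chain of vector sublattices. -/
def sUnionOfChain (c : Set (VectorSublattice E)) (hne : c.Nonempty)
    (hc : ∀ L ∈ c, ∀ M ∈ c, (L : Set E) ⊆ M ∨ (M : Set E) ⊆ L) : VectorSublattice E :=
  have hpair : ∀ {x y : E}, (∃ L ∈ c, x ∈ L) → (∃ L ∈ c, y ∈ L) → ∃ L ∈ c, x ∈ L ∧ y ∈ L := by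
    rintro x y ⟨L, hL, hx⟩ ⟨M, hM, hy⟩
    rcases hc L hL M hM with h | h
    · exact ⟨M, hM, h hx, hy⟩
    · exact ⟨L, hL, hx, h hy⟩
  { carrier := {x | ∃ L ∈ c, x ∈ L}
    add_mem' := fun hx hy => (hpair hx hy).imp fun _ h => ⟨h.1, add_mem h.2.1 h.2.2⟩
    zero_mem' := hne.imp fun L hL => ⟨hL, zero_mem L⟩
    smul_mem' := fun r _ hx => hx.imp fun L h => ⟨h.1, L.smul_mem r h.2⟩
    sup_mem' := fun _ _ hx hy => (hpair hx hy).imp fun L h => ⟨h.1, L.sup_mem h.2.1 h.2.2⟩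
    inf_mem' := fun _ _ hx hy => (hpair hx hy).imp fun L h => ⟨h.1, L.inf_mem h.2.1 h.2.2⟩ }

end VectorSublattice

end RelativelyUniform

/-! ### Extension of homomorphisms by maximal graphs -/

section Extension

variable {E U F : Type*} [AddCommGroup E] [Lattice E] [Module ℝ E] [IsOrderedAddMonoid E]
  [IsOrderedModule ℝ E] [AddCommGroup U] [Lattice U] [Module ℝ U] [IsOrderedAddMonoid U]
  [IsOrderedModule ℝ U] [AddCommGroup F] [Lattice F] [Module ℝ F] [IsOrderedAddMonoid F]
  [IsOrderedModule ℝ F]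

instance instIsOrderedModuleProd : IsOrderedModule ℝ (U × F) where
  smul_le_smul_of_nonneg_left _ ha _ _ hb :=
    ⟨smul_le_smul_of_nonneg_left hb.1 ha, smul_le_smul_of_nonneg_left hb.2 ha⟩
  smul_le_smul_of_nonneg_right _ hb _ _ ha :=
    ⟨smul_le_smul_of_nonneg_right ha hb.1, smul_le_smul_of_nonneg_right ha hb.2⟩

/-- The pairing of two vector lattice homomorphisms. -/
def VLHom.prod (S : VLHom E U) (T : VLHom E F) : VLHom E (U × F) where
  toLinearMap := S.toLinearMap.prod T.toLinearMap
  map_sup' x y := Prod.ext (S.map_sup' x y) (T.map_sup' x y)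
  map_inf' x y := Prod.ext (S.map_inf' x y) (T.map_inf' x y)

variable (U F) in
/-- The first projection as a vector lattice homomorphism. -/
def VLHom.fst : VLHom (U × F) U where
  toLinearMap := LinearMap.fst ℝ U F
  map_sup' _ _ := rfl
  map_inf' _ _ := rfl

variable (U F) in
/-- The second projection as a vector lattice homomorphism. -/
def VLHom.snd : VLHom (U × F) F where
  toLinearMap := LinearMap.snd ℝ U F
  map_sup' _ _ := rfl
  map_inf' _ _ := rfl

/-- A vector sublattice of a product that is the graph of a partially defined map. -/
def IsFunctional (Γ : VectorSublattice (U × F)) : Prop :=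
  ∀ y : F, ((0, y) : U × F) ∈ Γ → y = 0

theorem IsFunctional.eq {Γ : VectorSublattice (U × F)} (hΓ : IsFunctional Γ) {x : U} {y z : F}
    (hy : (x, y) ∈ Γ) (hz : (x, z) ∈ Γ) : y = z :=
  sub_eq_zero.1 <| hΓ _ <| by simpa using sub_mem hy hz

/-- A graph closed under suprema is order preserving: `z ⊔ w` has the same first coordinate as `w`,
hence also the same second one. -/
theorem IsFunctional.le_of_le {Γ : VectorSublattice (U × F)} (hΓ : IsFunctional Γ)
    {z w : U × F} (hz : z ∈ Γ) (hw : w ∈ Γ) (h : z.1 ≤ w.1) : z ≤ w := by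
  refine ⟨h, sup_eq_right.1 (hΓ.eq (x := w.1) ?_ hw)⟩
  have := Γ.sup_mem hz hw
  rwa [show z ⊔ w = (w.1, z.2 ⊔ w.2) from Prod.ext (sup_eq_right.2 h) rfl] at this

/-- Because the regulator lies in `Γ`, monotonicity carries the estimate `|f n| ≤ ε • p` from first
to second coordinates. So if the first coordinates tend to 0, the second ones do too. -/
theorem IsFunctional.ruStep (hF : IsArchimedean F) {Γ : VectorSublattice (U × F)}
    (hΓ : IsFunctional Γ) : IsFunctional Γ.ruStep := by
  rintro y ⟨f, p, hf, hp, h⟩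
  have hs := h.map (VLHom.snd U F)
  refine (hF.eq_of_ruBy (g' := 0) hs (q := p.2) fun ε hε => ?_)
  obtain ⟨N, hN⟩ := h ε hε
  refine ⟨N, fun n hn => ?_⟩
  have h1 : (|f n|).1 ≤ (ε • p).1 := by
    have := (hN n hn).1
    change |(f n).1 - 0| ≤ _ at this
    rwa [sub_zero] at this
  rw [sub_zero]
  exact (hΓ.le_of_le (Γ.abs_mem (hf n)) (Γ.smul_mem ε hp) h1).2

theorem exists_maximal_functional (Γ₀ : VectorSublattice (U × F)) (h₀ : IsFunctional Γ₀) :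
    ∃ Γ : VectorSublattice (U × F), (Γ₀ : Set (U × F)) ⊆ Γ ∧ IsFunctional Γ ∧
      ∀ Δ : VectorSublattice (U × F), (Γ : Set (U × F)) ⊆ Δ → IsFunctional Δ →
        (Δ : Set (U × F)) ⊆ Γ := by
  obtain ⟨m, hm0, ⟨Γ, rfl, hΓ⟩, hmax⟩ := zorn_subset_nonempty
    {s : Set (U × F) | ∃ Γ : VectorSublattice (U × F), (Γ : Set (U × F)) = s ∧ IsFunctional Γ}
    (by
      intro c hc hchain hne
      let C : Set (VectorSublattice (U × F)) := {Γ | (Γ : Set (U × F)) ∈ c}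
      have hCne : C.Nonempty := by
        obtain ⟨s, hs⟩ := hne
        obtain ⟨Γ, rfl, -⟩ := hc hs
        exact ⟨Γ, hs⟩
      refine ⟨_, ⟨VectorSublattice.sUnionOfChain C hCne
        (fun L hL M hM => hchain.total hL hM), rfl, ?_⟩, ?_⟩
      · rintro y ⟨L, hL, hy⟩
        obtain ⟨Γ, hΓL, hΓ⟩ := hc hL
        obtain rfl := SetLike.coe_injective hΓL
        exact hΓ y hy
      · intro s hs x hx
        obtain ⟨Γ, rfl, -⟩ := hc hs
        exact ⟨Γ, hs, hx⟩)
    (Γ₀ : Set (U × F)) ⟨Γ₀, rfl, h₀⟩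
  exact ⟨Γ, hm0, hΓ, fun Δ hΔ hf => hmax ⟨Δ, rfl, hf⟩ hΔ⟩

/-- The whole space is the only relatively uniformly closed vector sublattice that contains the
range of `φ`. -/
def RUGenerates (φ : VLHom E U) : Prop :=
  ∀ L : VectorSublattice U, L.RUClosed → (∀ x, φ x ∈ L) → ∀ y, y ∈ L

/-- Take a maximal functional graph containing all pairs `(φ x, T x)`. It absorbs its own relatively
uniform limits, and monotonicity makes the second coordinates Cauchy when the first ones converge.
Completeness of `F` thus makes the domain closed, hence everything. -/
theorem RUGenerates.exists_extension {φ : VLHom E U} (hφ : RUGenerates φ)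
    (hinj : Function.Injective φ) (hF : IsArchimedean F)
    (hc : UniformlyComplete F) (T : VLHom E F) : ∃ S : VLHom U F, ∀ x, S (φ x) = T x := by
  have h₀ : IsFunctional (φ.prod T).range := by
    rintro y ⟨x, hx⟩
    have h1 : φ x = φ 0 := (congrArg Prod.fst hx).trans (map_zero φ).symm
    have h2 : T x = y := congrArg Prod.snd hx
    rw [← h2, hinj h1, map_zero]
  obtain ⟨Γ, hΓ₀, hΓ, hmax⟩ := exists_maximal_functional _ h₀
  have hstep := hmax _ Γ.subset_ruStep (hΓ.ruStep hF)
  have hclosed : (Γ.map (VLHom.fst U F)).RUClosed := by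
    intro f p g hf hp h
    choose z hz hzf using fun n => VectorSublattice.mem_map.1 (hf n)
    obtain ⟨q, hq, rfl⟩ := VectorSublattice.mem_map.1 hp
    obtain rfl : (fun n => VLHom.fst U F (z n)) = f := funext hzf
    have hcauchy : RUCauchyBy q.2 fun n => (z n).2 := by
      intro ε hε
      obtain ⟨N, hN⟩ := h (ε / 2) (half_pos hε)
      refine ⟨N, fun m n hm hn => ?_⟩
      have h1 : (|z m - z n|).1 ≤ (ε • q).1 := by
        have := (abs_sub_le_abs_sub_add (z m).1 g (z n).1).trans
          (add_le_add (hN m hm) ((abs_sub_comm g (z n).1).trans_le (hN n hn)))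
        rw [← add_smul, add_halves] at this
        exact this
      exact (hΓ.le_of_le (Γ.abs_mem (sub_mem (hz m) (hz n))) (Γ.smul_mem ε hq) h1).2
    obtain ⟨y, hy⟩ := hc.exists_ruBy hF hcauchy
    refine VectorSublattice.mem_map.2 ⟨(g, y), hstep ⟨z, q, hz, hq, fun ε hε => ?_⟩, rfl⟩
    obtain ⟨N, hN⟩ := h ε hε
    obtain ⟨M, hM⟩ := hy ε hε
    exact ⟨max N M, fun n hn => ⟨hN n (le_of_max_le_left hn), hM n (le_of_max_le_right hn)⟩⟩
  have htotal : ∀ x, ∃ y, (x, y) ∈ Γ := fun x => by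
    obtain ⟨z, hz, rfl⟩ := VectorSublattice.mem_map.1 (hφ _ hclosed
      (fun x => VectorSublattice.mem_map.2 ⟨(φ x, T x), hΓ₀ ⟨x, rfl⟩, rfl⟩) x)
    exact ⟨z.2, hz⟩
  choose S hS using htotal
  exact ⟨{ toFun := S
           map_add' := fun x y => hΓ.eq (hS _) (add_mem (hS x) (hS y))
           map_smul' := fun c x => hΓ.eq (hS _) (Γ.smul_mem c (hS x))
           map_sup' := fun x y => hΓ.eq (hS _) (Γ.sup_mem (hS x) (hS y))
           map_inf' := fun x y => hΓ.eq (hS _) (Γ.inf_mem (hS x) (hS y)) },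
    fun x => hΓ.eq (hS _) (hΓ₀ ⟨x, rfl⟩)⟩

theorem RUGenerates.eq_of_comp_eq {φ : VLHom E U} (hφ : RUGenerates φ) (hF : IsArchimedean F)
    {S T : VLHom U F} (h : ∀ x, S (φ x) = T (φ x)) : S = T :=
  VLHom.ext <| hφ _ (VectorSublattice.ruClosed_eqLocus hF S T) h

end Extension

/-! ### Uniform completions and relatively uniform generation -/

section UniformCompletion

variable {E : Type u} [AddCommGroup E] [Lattice E] [Module ℝ E] [IsOrderedAddMonoid E]
  [IsOrderedModule ℝ E] {U : Type v} [AddCommGroup U] [Lattice U] [Module ℝ U]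
  [IsOrderedAddMonoid U] [IsOrderedModule ℝ U]

theorem RUGenerates.isUniformCompletion {φ : VLHom E U} (hφ : RUGenerates φ)
    (hinj : Function.Injective φ) (hU : IsArchimedean U) (hc : UniformlyComplete U) :
    IsUniformCompletion.{u, v, w} φ where
  archimedean := hU
  uniformlyComplete := hc
  injective := hinj
  universal F _ _ _ _ _ hF hcF T := by
    obtain ⟨S, hS⟩ := hφ.exists_extension hinj hF hcF T
    exact ⟨S, hS, fun S' hS' => hφ.eq_of_comp_eq hF fun x => (hS' x).trans (hS x).symm⟩

/-- A closed `L` containing the range is itself a valid test object. The resulting `U → L`, followed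
by the inclusion, is the identity by uniqueness, so `L` is everything. -/
theorem IsUniformCompletion.ruGenerates {φ : VLHom E U}
    (hφ : IsUniformCompletion.{u, v, v} φ) : RUGenerates φ := by
  intro L hL hφL y
  obtain ⟨S, hS, -⟩ := hφ.universal L (L.isArchimedean hφ.archimedean)
    (hL.uniformlyComplete hφ.archimedean hφ.uniformlyComplete) (φ.codRestrict L hφL)
  have h : L.subtype.comp S = VLHom.id :=
    (hφ.universal U hφ.archimedean hφ.uniformlyComplete φ).unique
      (fun x => congrArg Subtype.val (hS x)) fun _ => rfl
  have hy : ((S y : L) : U) = y := DFunLike.congr_fun h y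
  exact hy ▸ (S y).2

end UniformCompletion

/-! ### Germs along a filter with countable intersections -/

section Germs

open Filter

variable {X : Type*} {l : Filter X}

instance instIsOrderedModuleGerm : IsOrderedModule ℝ (Germ l ℝ) where
  smul_le_smul_of_nonneg_left c hc x y h := by
    induction x, y using Germ.inductionOn₂ with
    | _ f g => exact (Germ.coe_le.1 h).mono fun _ h => mul_le_mul_of_nonneg_left h hc
  smul_le_smul_of_nonneg_right x hx c d h := by
    induction x using Germ.inductionOn with
    | _ f => exact (Germ.coe_le.1 hx).mono fun _ hx => mul_le_mul_of_nonneg_right h hx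

variable [CountableInterFilter l]

theorem isArchimedean_germ : IsArchimedean (Germ l ℝ) := by
  intro x y h
  induction x, y using Germ.inductionOn₂ with
  | _ f g =>
    have h' : ∀ᶠ t in l, ∀ n : ℕ, n • f t ≤ g t :=
      eventually_countable_forall.2 fun n => Germ.coe_le.1 (h n)
    refine Germ.coe_le.2 (h'.mono fun t ht => ?_)
    by_contra! hlt
    obtain ⟨n, hn⟩ := Archimedean.arch (g t + 1) hlt
    linarith [ht n]

theorem uniformlyComplete_germ : UniformlyComplete (Germ l ℝ) := by
  intro F hF
  obtain ⟨q, hq, hF⟩ := hF.exists_ruCauchyBy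
  choose f hf using fun n => Quotient.exists_rep (F n)
  obtain rfl : (fun n => (f n : Germ l ℝ)) = F := funext hf
  induction q using Germ.inductionOn with
  | _ p =>
  choose N hN using fun k : ℕ => hF (1 / ((k : ℝ) + 1)) Nat.one_div_pos_of_nat
  -- Countably many estimates hold simultaneously for almost all `t`, and there the representatives
  -- are Cauchy sequences of reals.
  have hev : ∀ᶠ t in l, ∀ k m n : ℕ, N k ≤ m → N k ≤ n →
      |f m t - f n t| ≤ 1 / ((k : ℝ) + 1) * p t := by
    refine eventually_countable_forall.2 fun k => eventually_countable_forall.2 fun m =>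
      eventually_countable_forall.2 fun n => ?_
    by_cases hm : N k ≤ m
    · by_cases hn : N k ≤ n
      · exact (Germ.coe_le.1 (hN k m n hm hn)).mono fun t ht _ _ => ht
      · exact Eventually.of_forall fun t _ h => absurd h hn
    · exact Eventually.of_forall fun t h => absurd h hm
  have hlim : ∀ᶠ t in l, Tendsto (fun n => f n t) atTop (nhds (limUnder atTop fun n => f n t)) := by
    refine hev.mono fun t ht => CauchySeq.tendsto_limUnder (Metric.cauchySeq_iff.2 fun ε hε => ?_)
    obtain ⟨k, hk⟩ := exists_nat_gt (p t / ε)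
    refine ⟨N k, fun m hm n hn => (ht k m n hm hn).trans_lt ?_⟩
    rw [div_lt_iff₀ hε] at hk
    rw [one_div_mul_eq_div, div_lt_iff₀ (by positivity)]
    nlinarith
  -- Where the limit does not exist, `limUnder` has an arbitrary value that does not affect the
  -- germ.
  refine ⟨((fun t => limUnder atTop fun n => f n t : X → ℝ) : Germ l ℝ),
    RUBy.ruConverges hq fun ε hε => ?_⟩
  obtain ⟨M, hM⟩ := hF ε hε
  refine ⟨M, fun n hn => ?_⟩
  have hM' : ∀ᶠ t in l, ∀ m, M ≤ m → |f n t - f m t| ≤ ε * p t := by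
    refine eventually_countable_forall.2 fun m => ?_
    by_cases hm : M ≤ m
    · exact (Germ.coe_le.1 (hM n m hn hm)).mono fun t ht _ => ht
    · exact Eventually.of_forall fun t h => absurd h hm
  refine Germ.coe_le.2 ((hM'.and hlim).mono fun t ht => ?_)
  exact le_of_tendsto (tendsto_const_nhds.sub ht.2).abs
    (eventually_atTop.2 ⟨M, fun m hm => ht.1 m hm⟩)

end Germs

/-! ### Embedding into germs of functions -/

section Embedding

open Filter

variable {E : Type*} [AddCommGroup E] [Lattice E] [Module ℝ E]

/-- The real functions on `E` that restrict to a homomorphism on the vector sublattice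
generated by `A`. -/
def homOn (A : Set E) : Set (E → ℝ) :=
  {ω | ∃ T : VLHom (VectorSublattice.closure A) ℝ, ∀ x : VectorSublattice.closure A, ω x = T x}

theorem homOn_anti {A B : Set E} (h : A ⊆ B) : homOn B ⊆ homOn A := fun _ ⟨T, hT⟩ =>
  ⟨T.comp (VectorSublattice.inclusion (VectorSublattice.closure_mono h)), fun x =>
    hT ⟨x, VectorSublattice.closure_mono h x.2⟩⟩

variable (E) in
/-- The filter generated by the sets of functions that are homomorphisms on a countably generated
vector sublattice. -/
def homFilter : Filter (E → ℝ) :=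
  Filter.ofCountableInter {s | ∃ A : Set E, A.Countable ∧ homOn A ⊆ s}
    (fun S hS h => by
      choose! A hA hAS using fun s (hs : s ∈ S) => h hs
      exact ⟨⋃ s ∈ S, A s, hS.biUnion fun s hs => hA s hs, fun ω hω s hs =>
        hAS s hs (homOn_anti (Set.subset_biUnion_of_mem hs) hω)⟩)
    (fun _ _ ⟨A, hA, h⟩ hst => ⟨A, hA, h.trans hst⟩)

instance : CountableInterFilter (homFilter E) := by
  unfold homFilter
  infer_instance

theorem eventually_homFilter {A : Set E} (hA : A.Countable) :
    ∀ᶠ ω in homFilter E, ∃ T : VLHom (VectorSublattice.closure A) ℝ, ∀ x : VectorSublattice.closure A, ω x = T x :=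
  ⟨A, hA, fun _ h => h⟩

variable (E) in
/-- Evaluation, as a homomorphism into a space of germs of real functions. -/
def evalGerm : VLHom E (Germ (homFilter E) ℝ) :=
  -- Each homomorphism identity involves at most two elements, so it holds for all `ω` that are
  -- homomorphisms on the sublattice they generate.
  have key : ∀ x y : E, ∀ᶠ ω in homFilter E,
      ∃ T : VLHom (VectorSublattice.closure {x, y}) ℝ, ∀ z, ω (z : E) = T z := fun x y =>
    eventually_homFilter ((Set.countable_singleton y).insert x)
  have hl : ∀ x y : E, x ∈ VectorSublattice.closure {x, y} := fun x y =>
    VectorSublattice.subset_closure _ (Or.inl rfl)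
  have hr : ∀ x y : E, y ∈ VectorSublattice.closure {x, y} := fun x y =>
    VectorSublattice.subset_closure _ (Or.inr rfl)
  { toFun := fun x => ((fun ω => ω x : (E → ℝ) → ℝ) : Germ (homFilter E) ℝ)
    map_add' := fun x y => Germ.coe_eq.2 <| (key x y).mono fun ω ⟨T, hT⟩ => by
      have h := map_add T ⟨x, hl x y⟩ ⟨y, hr x y⟩
      rw [← hT, ← hT, ← hT] at h
      exact h
    map_smul' := fun c x => Germ.coe_eq.2 <| (key x x).mono fun ω ⟨T, hT⟩ => by
      have h := map_smul T c ⟨x, hl x x⟩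
      rw [← hT, ← hT] at h
      exact h
    map_sup' := fun x y => Germ.coe_eq.2 <| (key x y).mono fun ω ⟨T, hT⟩ => by
      have h := T.map_sup' ⟨x, hl x y⟩ ⟨y, hr x y⟩
      change T _ = T _ ⊔ T _ at h
      rw [← hT, ← hT, ← hT] at h
      exact h
    map_inf' := fun x y => Germ.coe_eq.2 <| (key x y).mono fun ω ⟨T, hT⟩ => by
      have h := T.map_inf' ⟨x, hl x y⟩ ⟨y, hr x y⟩
      change T _ = T _ ⊓ T _ at h
      rw [← hT, ← hT, ← hT] at h
      exact h }

theorem IsArchimedean.evalGerm_injective [IsOrderedAddMonoid E] [IsOrderedModule ℝ E]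
    (hE : IsArchimedean E) : Function.Injective (evalGerm E) := by
  refine (injective_iff_map_eq_zero _).2 fun x hx => ?_
  by_contra hne
  obtain ⟨A, hA, hAx⟩ : ∀ᶠ ω in homFilter E, ω x = 0 := by
    have h : ((fun ω => ω x : (E → ℝ) → ℝ) : Germ (homFilter E) ℝ) =
      ((fun _ => 0 : (E → ℝ) → ℝ) : Germ (homFilter E) ℝ) := hx
    exact Germ.coe_eq.1 h
  have hpos : 0 < |x| := lt_of_le_of_ne (abs_nonneg x) fun h => hne (eq_zero_of_abs_le_zero h.ge)
  obtain ⟨L, hL, T, hAL, hT⟩ := hE.exists_sublattice_hom (hA.insert x) hpos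
  have hAL' : (VectorSublattice.closure A : Set E) ⊆ L :=
    VectorSublattice.closure_le ((Set.subset_insert x A).trans hAL)
  have hxL : x ∈ L := hAL (Set.mem_insert x A)
  classical
  -- The value 0 off `L` is arbitrary: membership in `homOn A` concerns only the sublattice
  -- generated by `A`, which lies in `L`.
  let ω : E → ℝ := fun y => if h : y ∈ L then T ⟨y, h⟩ else 0
  have h0 : ω x = 0 := hAx ⟨T.comp (VectorSublattice.inclusion hAL'), fun y =>
    dif_pos (hAL' y.2)⟩
  have h1 : T ⟨x, hxL⟩ = 0 := (dif_pos hxL).symm.trans h0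
  have h2 : (⟨|x|, hL⟩ : L) = |⟨x, hxL⟩| := rfl
  rw [h2, T.map_abs, h1, abs_zero] at hT
  exact zero_ne_one hT

end Embedding

/-- Every Archimedean vector lattice has a uniform completion in its own universe. -/
theorem IsArchimedean.exists_ruGenerates {E : Type u} [AddCommGroup E] [Lattice E] [Module ℝ E]
    [IsOrderedAddMonoid E] [IsOrderedModule ℝ E] (hE : IsArchimedean E) :
    ∃ (U : Type u) (_ : AddCommGroup U) (_ : Lattice U) (_ : Module ℝ U)
      (_ : IsOrderedAddMonoid U) (_ : IsOrderedModule ℝ U) (φ : VLHom E U),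
      IsArchimedean U ∧ UniformlyComplete U ∧ Function.Injective φ ∧ RUGenerates φ := by
  let L := VectorSublattice.ruClosure (Set.range (evalGerm E))
  have hL : L.RUClosed := VectorSublattice.ruClosed_ruClosure _
  have hmem : ∀ x, evalGerm E x ∈ L := fun x => VectorSublattice.subset_ruClosure _ ⟨x, rfl⟩
  refine ⟨L, inferInstance, inferInstance, inferInstance, inferInstance, inferInstance,
    (evalGerm E).codRestrict L hmem, L.isArchimedean isArchimedean_germ,
    hL.uniformlyComplete isArchimedean_germ uniformlyComplete_germ,
    fun x y h => hE.evalGerm_injective (congrArg Subtype.val h), fun M hM hφ y => ?_⟩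
  -- The image of `M` in the germs is closed and contains the image of `E`, so it contains the whole
  -- closure `L`.
  obtain ⟨z, hz, hzy⟩ := VectorSublattice.mem_map.1 (y.2 _ (hL.map_subtype hM) (by
    rintro _ ⟨x, rfl⟩
    exact VectorSublattice.mem_map.2 ⟨_, hφ x, rfl⟩))
  obtain rfl : z = y := Subtype.ext hzy
  exact hz

/-! ### Approximation by lattice-linear functions -/

section LatticeLinear

/-- The vector lattice of functions on `ℝ^m` generated by the coordinates. -/
def latticeLinear (m : ℕ) : VectorSublattice ((Fin m → ℝ) → ℝ) :=
  VectorSublattice.closure (Set.range fun i x => x i)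

variable {m : ℕ}

theorem coord_mem_latticeLinear (i : Fin m) :
    (fun x : Fin m → ℝ => x i) ∈ latticeLinear m :=
  VectorSublattice.subset_closure _ ⟨i, rfl⟩

theorem continuous_of_mem_latticeLinear {g : (Fin m → ℝ) → ℝ} (hg : g ∈ latticeLinear m) :
    Continuous g :=
  hg { carrier := {g | Continuous g}
       add_mem' := fun hf hg => hf.add hg
       zero_mem' := continuous_const
       smul_mem' := fun c _ hf => hf.const_smul c
       sup_mem' := fun _ _ hf hg => hf.sup hg
       inf_mem' := fun _ _ hf hg => hf.inf hg } <| by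
    rintro _ ⟨i, rfl⟩
    exact continuous_apply i

theorem map_smul_of_mem_latticeLinear {g : (Fin m → ℝ) → ℝ} (hg : g ∈ latticeLinear m) :
    ∀ (c : ℝ) (x : Fin m → ℝ), 0 ≤ c → g (c • x) = c * g x :=
  hg { carrier := {g | ∀ (c : ℝ) (x : Fin m → ℝ), 0 ≤ c → g (c • x) = c * g x}
       add_mem' := fun hf hg c x hc => by
        rw [Pi.add_apply, Pi.add_apply, hf c x hc, hg c x hc, mul_add]
       zero_mem' := fun c x _ => (mul_zero c).symm
       smul_mem' := fun r _ hf c x hc => by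
        rw [Pi.smul_apply, Pi.smul_apply, hf c x hc, smul_eq_mul, smul_eq_mul, mul_left_comm]
       sup_mem' := fun _ _ hf hg c x hc => by
        rw [Pi.sup_apply, Pi.sup_apply, hf c x hc, hg c x hc]
        exact (mul_max_of_nonneg _ _ hc).symm
       inf_mem' := fun _ _ hf hg c x hc => by
        rw [Pi.inf_apply, Pi.inf_apply, hf c x hc, hg c x hc]
        exact (mul_min_of_nonneg _ _ hc).symm } <| by
    rintro _ ⟨i, rfl⟩ c x -
    rfl

theorem exists_abs_apply_eq_one {x : Fin m → ℝ} (hx : ‖x‖ = 1) : ∃ i, |x i| = 1 := by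
  by_contra! h
  refine hx.not_lt ((pi_norm_lt_iff one_pos).2 fun i => ?_)
  exact lt_of_le_of_ne ((norm_le_pi_norm x i).trans hx.le) (h i)

/-- If `x` and `y` are not proportional, a nonzero 2×2 minor gives a separating linear function.
Distinct proportional points of the unit sphere are antipodal, and there the positive part of a
coordinate multiple separates them. -/
theorem exists_latticeLinear_separating {x y : Fin m → ℝ} (hx : ‖x‖ = 1) (hy : ‖y‖ = 1)
    (hxy : x ≠ y) : ∃ g ∈ latticeLinear m, g x = 1 ∧ g y = 0 := by
  by_cases h : ∀ i j, x i * y j = x j * y i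
  · obtain ⟨j, hj⟩ := exists_abs_apply_eq_one hy
    obtain ⟨i, hi⟩ := exists_abs_apply_eq_one hx
    have hyj : y j * y j = 1 := by rw [← abs_mul_abs_self, hj, one_mul]
    have hxi : x i * x i = 1 := by rw [← abs_mul_abs_self, hi, one_mul]
    set c := x j * y j with hc
    have hxc : ∀ k, x k = c * y k := fun k => by
      calc x k = x k * y j * y j := by rw [mul_assoc, hyj, mul_one]
        _ = c * y k := by rw [h k j, hc]; ring
    -- The coordinates of both points are at most 1 in modulus: `c * c = x j * x j` gives `≤ 1`, and
    -- `c * c * (y i * y i) = 1` gives `≥ 1`.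
    have hcc : c * c = 1 := by
      have h1 : c * c * (y i * y i) = 1 := by rw [← hxi, hxc i]; ring
      have h2 : c * c = x j * x j := by rw [hc]; linear_combination x j * x j * hyj
      have hb : ∀ (z : Fin m → ℝ), ‖z‖ = 1 → ∀ k, z k * z k ≤ 1 := fun z hz k => by
        have := (norm_le_pi_norm z k).trans hz.le
        rw [Real.norm_eq_abs] at this
        rw [← abs_mul_abs_self]
        nlinarith [abs_nonneg (z k)]
      nlinarith [hb x hx j, hb y hy i, mul_self_nonneg (y i), mul_self_nonneg c]
    have hc1 : c = -1 := by
      rcases mul_self_eq_one_iff.1 hcc with h1 | h1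
      · exact absurd (funext fun k => by rw [hxc k, h1, one_mul]) hxy
      · exact h1
    refine ⟨(x i • fun z : Fin m → ℝ => z i) ⊔ 0, (latticeLinear m).sup_mem
      ((latticeLinear m).smul_mem _ (coord_mem_latticeLinear i)) (zero_mem _), ?_, ?_⟩
    · change x i * x i ⊔ 0 = 1
      rw [hxi]
      exact max_eq_left zero_le_one
    · change x i * y i ⊔ 0 = 0
      have : y i = -x i := by rw [hxc i, hc1]; ring
      rw [this]
      exact max_eq_right (by linarith)
  · push Not at h
    obtain ⟨i, j, hij⟩ := h
    have hd : x i * y j - x j * y i ≠ 0 := sub_ne_zero.2 hij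
    refine ⟨(x i * y j - x j * y i)⁻¹ • (y j • (fun z : Fin m → ℝ => z i) - y i • fun z => z j),
      (latticeLinear m).smul_mem _ (sub_mem
        ((latticeLinear m).smul_mem _ (coord_mem_latticeLinear i))
        ((latticeLinear m).smul_mem _ (coord_mem_latticeLinear j))), ?_, ?_⟩
    · change (x i * y j - x j * y i)⁻¹ * (y j * x i - y i * x j) = 1
      rw [mul_comm (y j), mul_comm (y i)]
      exact inv_mul_cancel₀ hd
    · change (x i * y j - x j * y i)⁻¹ * (y j * y i - y i * y j) = 0
      rw [mul_comm (y j), sub_self, mul_zero]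

/-- The lattice form of Stone–Weierstrass requires arbitrary values at two points; constants are not
assumed to be available. -/
theorem exists_latticeLinear_interpolating {x y : Fin m → ℝ} (hx : ‖x‖ = 1) (hy : ‖y‖ = 1)
    (v : (Fin m → ℝ) → ℝ) : ∃ g ∈ latticeLinear m, g x = v x ∧ g y = v y := by
  by_cases hxy : x = y
  · subst hxy
    obtain ⟨i, hi⟩ := exists_abs_apply_eq_one hx
    have hxi : x i * x i = 1 := by rw [← abs_mul_abs_self, hi, one_mul]
    have h : ((v x * x i) • fun z : Fin m → ℝ => z i) x = v x := by
      change v x * x i * x i = v x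
      rw [mul_assoc, hxi, mul_one]
    exact ⟨_, (latticeLinear m).smul_mem _ (coord_mem_latticeLinear i), h, h⟩
  · obtain ⟨f, hf, hfx, hfy⟩ := exists_latticeLinear_separating hx hy hxy
    obtain ⟨g, hg, hgy, hgx⟩ := exists_latticeLinear_separating hy hx (Ne.symm hxy)
    refine ⟨v x • f + v y • g, add_mem ((latticeLinear m).smul_mem _ hf)
      ((latticeLinear m).smul_mem _ hg), ?_, ?_⟩
    · simp [hfx, hgx]
    · simp [hfy, hgy]

/-- Continuous positively homogeneous functions are approximated by lattice-linear functions,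
uniformly relative to the norm. -/
theorem HFun.exists_latticeLinear_approx (h : HFun) {ε : ℝ} (hε : 0 < ε) :
    ∃ g ∈ latticeLinear h.arity, ∀ x, |h.toFun x - g x| ≤ ε * ∑ i, |x i| := by
  let K := Metric.sphere (0 : Fin h.arity → ℝ) 1
  have hK : ∀ x : K, ‖(x : Fin h.arity → ℝ)‖ = 1 := fun x => mem_sphere_zero_iff_norm.1 x.2
  let L : Set C(K, ℝ) := {f | ∃ g ∈ latticeLinear h.arity, ∀ x : K, f x = g x}
  have htop : closure L = ⊤ := ContinuousMap.sublattice_closure_eq_top L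
    ⟨0, 0, zero_mem _, fun _ => rfl⟩
    (fun f ⟨g, hg, hf⟩ f' ⟨g', hg', hf'⟩ => ⟨g ⊓ g', (latticeLinear _).inf_mem hg hg', fun x => by
      rw [ContinuousMap.inf_apply, hf, hf', Pi.inf_apply]⟩)
    (fun f ⟨g, hg, hf⟩ f' ⟨g', hg', hf'⟩ => ⟨g ⊔ g', (latticeLinear _).sup_mem hg hg', fun x => by
      rw [ContinuousMap.sup_apply, hf, hf', Pi.sup_apply]⟩)
    (fun v x y => by
      classical
      obtain ⟨g, hg, hx, hy⟩ := exists_latticeLinear_interpolating (hK x) (hK y)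
        fun z => if hz : z ∈ K then v ⟨z, hz⟩ else 0
      refine ⟨⟨fun z => g z, (continuous_of_mem_latticeLinear hg).comp continuous_subtype_val⟩,
        ⟨g, hg, fun _ => rfl⟩, hx.trans (dif_pos x.2), hy.trans (dif_pos y.2)⟩)
  let hC : C(K, ℝ) := ⟨fun x => h.toFun x, h.continuous.comp continuous_subtype_val⟩
  have hmem : hC ∈ closure L := htop ▸ Set.mem_univ hC
  obtain ⟨f, ⟨g, hg, hf⟩, hdist⟩ := Metric.mem_closure_iff.1 hmem ε hε
  refine ⟨g, hg, fun x => ?_⟩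
  -- The norm is replaced by `∑ i, |x i|`, which makes sense in any vector lattice and will serve as
  -- regulator.
  have hsum : ‖x‖ ≤ ∑ i, |x i| := (pi_norm_le_iff_of_nonneg
    (Finset.sum_nonneg fun i _ => abs_nonneg (x i))).2 fun i =>
      Finset.single_le_sum (f := fun i => |x i|) (fun i _ => abs_nonneg (x i)) (Finset.mem_univ i)
  refine le_trans ?_ (mul_le_mul_of_nonneg_left hsum hε.le)
  rcases eq_or_ne x 0 with rfl | hx
  · have h1 := h.homogeneous 0 0 le_rfl
    have h2 := map_smul_of_mem_latticeLinear hg 0 0 le_rfl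
    rw [zero_smul, zero_mul] at h1 h2
    rw [h1, h2]
    simp
  · have hn : 0 < ‖x‖ := norm_pos_iff.2 hx
    have hu : ‖x‖⁻¹ • x ∈ K := by
      rw [mem_sphere_zero_iff_norm, norm_smul, norm_inv, norm_norm, inv_mul_cancel₀ hn.ne']
    have h1 : |h.toFun (‖x‖⁻¹ • x) - g (‖x‖⁻¹ • x)| ≤ ε := by
      rw [← hf ⟨_, hu⟩]
      exact (ContinuousMap.dist_apply_le_dist ⟨_, hu⟩).trans hdist.le
    have hxu : x = ‖x‖ • ‖x‖⁻¹ • x := (smul_inv_smul₀ hn.ne' x).symm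
    have h2 := h.homogeneous ‖x‖ (‖x‖⁻¹ • x) hn.le
    have h3 := map_smul_of_mem_latticeLinear hg ‖x‖ (‖x‖⁻¹ • x) hn.le
    rw [← hxu] at h2 h3
    rw [h2, h3, ← mul_sub, abs_mul, abs_of_pos hn, mul_comm ε]
    exact mul_le_mul_of_nonneg_left h1 hn.le

end LatticeLinear

/-! ### Functional calculus -/

section Calculus

variable {E F : Type*} [AddCommGroup E] [Lattice E] [Module ℝ E]
  [AddCommGroup F] [Lattice F] [Module ℝ F] {h : HFun}

/-- Restriction to the generated sublattice gives this for nonzero restrictions; the zero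
homomorphism is harmless since `h` vanishes at 0. -/
theorem CalcEq.apply_of_mem {a : Fin h.arity → E} {b : E} (hab : CalcEq h a b)
    {L : VectorSublattice E} (ω : VLHom L ℝ) (ha : ∀ i, a i ∈ L) (hb : b ∈ L) :
    h.toFun (fun i => ω ⟨a i, ha i⟩) = ω ⟨b, hb⟩ := by
  have hL : (VectorSublattice.closure (Set.range a ∪ {b}) : Set E) ⊆ L := by
    refine VectorSublattice.closure_le ?_
    rintro _ (⟨i, rfl⟩ | rfl)
    · exact ha i
    · exact hb
  let ω' := ω.comp (VectorSublattice.inclusion hL)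
  by_cases hω : ∃ x, ω' x ≠ 0
  · exact hab ω' hω
  · push Not at hω
    have h1 : ∀ i, ω ⟨a i, ha i⟩ = 0 := fun i =>
      hω ⟨a i, VectorSublattice.subset_closure _ (Or.inl ⟨i, rfl⟩)⟩
    have h2 : ω ⟨b, hb⟩ = 0 := hω ⟨b, VectorSublattice.subset_closure _ (Or.inr rfl)⟩
    have h3 := h.homogeneous 0 0 le_rfl
    rw [zero_smul, zero_mul] at h3
    simp only [h1, h2]
    exact h3

/-- A homomorphism on the sublattice generated by the images pulls back along `T` to its preimage,
which contains the original elements. -/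
theorem CalcEq.map {a : Fin h.arity → E} {b : E} (hab : CalcEq h a b) (T : VLHom E F) :
    CalcEq h (fun i => T (a i)) (T b) := fun ω _ =>
  let C := VectorSublattice.closure (Set.range (fun i => T (a i)) ∪ {T b})
  let L := VectorSublattice.comap T C
  hab.apply_of_mem (L := L) (ω.comp ((T.comp L.subtype).codRestrict C fun x => x.2))
    (fun i => VectorSublattice.subset_closure _ (Or.inl ⟨i, rfl⟩))
    (VectorSublattice.subset_closure _ (Or.inr rfl))

/-- The sublattice generated inside `L` is isomorphic to its image in `E`, so homomorphisms
transport along the inverse. -/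
theorem CalcEq.of_coe {L : VectorSublattice E} {a : Fin h.arity → L} {b : L}
    (hab : CalcEq h (fun i => (a i : E)) (b : E)) : CalcEq h a b := fun ω _ => by
  let C := VectorSublattice.closure (Set.range a ∪ {b})
  let M := VectorSublattice.map L.subtype C
  have hM : ∀ x : C, L.subtype.comp C.subtype x ∈ M := fun x => ⟨x, rfl⟩
  let T : VLHom C M := (L.subtype.comp C.subtype).codRestrict M hM
  have hT : Function.Bijective T :=
    ⟨fun x y hxy => Subtype.ext (Subtype.ext (congrArg (fun z : M => (z : E)) hxy)),
      fun ⟨_, x, hx⟩ => ⟨x, Subtype.ext hx⟩⟩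
  have key := fun x : C => congrArg ω (T.inverse_apply hT x)
  have := hab.apply_of_mem (ω.comp (T.inverse hT))
    (fun i => hM ⟨a i, VectorSublattice.subset_closure _ (Or.inl ⟨i, rfl⟩)⟩)
    (hM ⟨b, VectorSublattice.subset_closure _ (Or.inr rfl)⟩)
  refine Eq.trans (congrArg h.toFun (funext fun i => ?_)) (this.trans (key ⟨b, _⟩))
  exact (key ⟨a i, _⟩).symm

variable [IsOrderedAddMonoid E] [IsOrderedModule ℝ E]

theorem CalcEq.unique (hE : IsArchimedean E) {a : Fin h.arity → E} {b c : E}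
    (hb : CalcEq h a b) (hc : CalcEq h a c) : b = c := by
  let A : Set E := Set.range a ∪ {b, c}
  have hA : A.Countable := (Set.countable_range a).union ((Set.countable_singleton c).insert b)
  have ha : ∀ i, a i ∈ VectorSublattice.closure A := fun i =>
    VectorSublattice.subset_closure _ (Or.inl ⟨i, rfl⟩)
  have hbA : b ∈ VectorSublattice.closure A :=
    VectorSublattice.subset_closure _ (Or.inr (Or.inl rfl))
  have hcA : c ∈ VectorSublattice.closure A :=
    VectorSublattice.subset_closure _ (Or.inr (Or.inr rfl))
  exact congrArg Subtype.val (hE.eq_of_forall_hom hA (y := ⟨b, hbA⟩) (z := ⟨c, hcA⟩) fun ω =>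
    (hb.apply_of_mem ω ha hbA).symm.trans (hc.apply_of_mem ω ha hcA))

/-- Lattice-linear functions act on finite families of a vector lattice. -/
theorem exists_forall_hom_eq_latticeLinear {m : ℕ} (a : Fin m → E) {g : (Fin m → ℝ) → ℝ}
    (hg : g ∈ latticeLinear m) : ∃ y : VectorSublattice.closure (Set.range a),
      ∀ ω : VLHom (VectorSublattice.closure (Set.range a)) ℝ,
        ω y = g fun i => ω ⟨a i, VectorSublattice.subset_closure _ ⟨i, rfl⟩⟩ :=
  hg { carrier := {g | ∃ y : VectorSublattice.closure (Set.range a),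
        ∀ ω : VLHom (VectorSublattice.closure (Set.range a)) ℝ,
          ω y = g fun i => ω ⟨a i, VectorSublattice.subset_closure _ ⟨i, rfl⟩⟩}
       add_mem' := fun ⟨y, hy⟩ ⟨z, hz⟩ => ⟨y + z, fun ω => by
        rw [map_add, hy, hz, Pi.add_apply]⟩
       zero_mem' := ⟨0, fun ω => map_zero ω⟩
       smul_mem' := fun c _ ⟨y, hy⟩ => ⟨c • y, fun ω => by rw [map_smul, hy, Pi.smul_apply]⟩
       sup_mem' := fun _ _ ⟨y, hy⟩ ⟨z, hz⟩ => ⟨y ⊔ z, fun ω => by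
        rw [map_sup, hy, hz, Pi.sup_apply]⟩
       inf_mem' := fun _ _ ⟨y, hy⟩ ⟨z, hz⟩ => ⟨y ⊓ z, fun ω => by
        rw [map_inf, hy, hz, Pi.inf_apply]⟩ } <| by
    rintro _ ⟨i, rfl⟩
    exact ⟨⟨a i, VectorSublattice.subset_closure _ ⟨i, rfl⟩⟩, fun ω => rfl⟩

theorem isArchimedean_real : IsArchimedean ℝ := by
  intro x y h
  by_contra! hx
  obtain ⟨n, hn⟩ := Archimedean.arch (y + 1) hx
  linarith [h n]

/-- Uniformly complete Archimedean vector lattices are closed under the functional calculus of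
continuous positively homogeneous functions. -/
theorem UniformlyComplete.exists_calcEq (hE : IsArchimedean E) (hc : UniformlyComplete E)
    (h : HFun) (a : Fin h.arity → E) : ∃ b, CalcEq h a b := by
  let C := VectorSublattice.closure (Set.range a)
  let e : Fin h.arity → C := fun i => ⟨a i, VectorSublattice.subset_closure _ ⟨i, rfl⟩⟩
  let p : C := ∑ i, |e i|
  have happrox : ∀ n : ℕ, ∃ y : C, ∀ ω : VLHom C ℝ,
      |h.toFun (fun i => ω (e i)) - ω y| ≤ 1 / ((n : ℝ) + 1) * ω p := by
    intro n
    obtain ⟨g, hg, hhg⟩ := h.exists_latticeLinear_approx (Nat.one_div_pos_of_nat (n := n))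
    obtain ⟨y, hy⟩ := exists_forall_hom_eq_latticeLinear a hg
    refine ⟨y, fun ω => ?_⟩
    rw [hy ω, map_sum]
    simp only [ω.map_abs]
    exact hhg _
  choose y hy using happrox
  have hp : ∀ ω : VLHom C ℝ, 0 ≤ ω p := fun ω => by
    rw [map_sum]
    exact Finset.sum_nonneg fun i _ => by
      rw [ω.map_abs]
      exact abs_nonneg _
  have hsmall : ∀ ε : ℝ, 0 < ε → ∃ N : ℕ, ∀ n, N ≤ n → ∀ ω : VLHom C ℝ,
      |h.toFun (fun i => ω (e i)) - ω (y n)| ≤ ε * ω p := by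
    intro ε hε
    obtain ⟨N, hN⟩ := exists_nat_one_div_lt hε
    refine ⟨N, fun n hn ω => (hy n ω).trans (mul_le_mul_of_nonneg_right ?_ (hp ω))⟩
    exact (Nat.one_div_le_one_div hn).trans hN.le
  -- Estimates under all real homomorphisms become estimates in `E`, because these homomorphisms
  -- determine the order of the sublattice generated by `a`.
  have hcauchy : RUCauchyBy (p : E) fun n => (y n : E) := by
    intro ε hε
    obtain ⟨N, hN⟩ := hsmall (ε / 2) (half_pos hε)
    refine ⟨N, fun m n hm hn => ?_⟩
    refine hE.le_of_forall_hom (Set.countable_range a) (y := |y m - y n|) (z := ε • p) fun ω => ?_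
    rw [ω.map_abs, map_sub, map_smul, smul_eq_mul]
    have h1 := hN m hm ω
    rw [abs_sub_comm] at h1
    have := (abs_sub_le_abs_sub_add _ _ _).trans (add_le_add h1 (hN n hn ω))
    rwa [← add_mul, add_halves] at this
  obtain ⟨b, hb⟩ := hc.exists_ruBy hE hcauchy
  refine ⟨b, fun ω _ => ?_⟩
  let J := VectorSublattice.inclusion
    (VectorSublattice.closure_mono (Set.subset_union_left (s := Set.range a) (t := {b})))
  -- Under `ω` the approximants converge to `ω b` by preservation of limits and to `h(ω(a))` by the
  -- approximation estimate; limits in `ℝ` are unique.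
  have h1 : RUBy (ω (J p)) (fun n => ω (J (y n)))
      (ω ⟨b, VectorSublattice.subset_closure _ (Or.inr rfl)⟩) :=
    RUBy.map (p := J p) (f := fun n => J (y n)) (g := ⟨b, _⟩) ω hb
  have h2 : RUBy (ω (J p)) (fun n => ω (J (y n))) (h.toFun fun i => ω (J (e i))) := fun ε hε =>
    (hsmall ε hε).imp fun N hN n hn => by
      rw [abs_sub_comm]
      exact hN n hn (ω.comp J)
  exact isArchimedean_real.eq_of_ruBy h2 h1

theorem UniformlyComplete.dComplete (hE : IsArchimedean E) (hc : UniformlyComplete E)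
    (D : Set HFun) : DComplete E D :=
  fun h _ a => hc.exists_calcEq hE h a

end Calculus

/-! ### The hull and its induction principle -/

section Hull

variable {E G F : Type*} [AddCommGroup E] [Lattice E] [Module ℝ E]
  [AddCommGroup G] [Lattice G] [Module ℝ G]
  [AddCommGroup F] [Lattice F] [Module ℝ F] {D : Set HFun}

theorem dChain_mono (D : Set HFun) (φ : VLHom E G) {m n : ℕ} (hmn : m ≤ n) :
    (dChain D φ m : Set G) ⊆ dChain D φ n :=
  monotone_nat_of_le_succ (f := fun n => (dChain D φ n : Set G)) (dChain_subset_succ D φ) hmn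

theorem mem_dHull {φ : VLHom E G} {y : G} : y ∈ dHull D φ ↔ ∃ n, y ∈ dChain D φ n := Iff.rfl

theorem mem_dHull_of_calcEq {φ : VLHom E G} {h : HFun} (hh : h ∈ D) {a : Fin h.arity → G}
    (ha : ∀ i, a i ∈ dHull D φ) {b : G} (hab : CalcEq h a b) : b ∈ dHull D φ := by
  choose n hn using fun i => mem_dHull.1 (ha i)
  -- The finitely many arguments lie in a common stage, and `h(a)` enters at the next one.
  refine mem_dHull.2 ⟨Finset.univ.sup n + 1, VectorSublattice.subset_closure _ (Or.inr
    ⟨h, hh, a, fun i => ?_, hab⟩)⟩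
  exact dChain_mono D φ (Finset.le_sup (Finset.mem_univ i)) (hn i)

/-- The hull is the smallest vector sublattice that contains the range of `φ` and is closed under
the functional calculus of `D` inside the hull. -/
theorem dHull_induction {φ : VLHom E G} {L : VectorSublattice G} (hφ : ∀ x, φ x ∈ L)
    (hL : ∀ h ∈ D, ∀ (a : Fin h.arity → G) (b : G), (∀ i, a i ∈ dHull D φ) → b ∈ dHull D φ →
      (∀ i, a i ∈ L) → CalcEq h a b → b ∈ L) :
    (dHull D φ : Set G) ⊆ L := by
  suffices H : ∀ n, (dChain D φ n : Set G) ⊆ L from fun y ⟨n, hn⟩ => H n hn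
  intro n
  induction n with
  | zero =>
    rintro _ ⟨x, rfl⟩
    exact hφ x
  | succ n ih =>
    refine VectorSublattice.closure_le ?_
    rintro b (hb | ⟨h, hh, a, ha, hab⟩)
    · exact ih hb
    · exact hL h hh a b (fun i => ⟨n, ha i⟩)
        (mem_dHull_of_calcEq hh (fun i => ⟨n, ha i⟩) hab) (fun i => ih (ha i)) hab

variable [IsOrderedAddMonoid G] [IsOrderedModule ℝ G]

theorem dComplete_dHull (hG : IsArchimedean G) (hc : UniformlyComplete G) (D : Set HFun)
    (φ : VLHom E G) : DComplete (dHull D φ) D := by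
  intro h hh a
  obtain ⟨b, hb⟩ := hc.exists_calcEq hG h fun i => (a i : G)
  exact ⟨⟨b, mem_dHull_of_calcEq hh (fun i => (a i).2) hb⟩, CalcEq.of_coe hb⟩

variable [IsOrderedAddMonoid F] [IsOrderedModule ℝ F]

/-- Both homomorphisms send `h(a)` to the unique value of `h` at the images of `a`, so agreement
propagates along the chain. -/
theorem eq_of_comp_toDHull_eq (hF : IsArchimedean F) {φ : VLHom E G}
    {S T : VLHom (dHull D φ) F} (h : ∀ x, S (toDHull D φ x) = T (toDHull D φ x)) : S = T := by
  let L := VectorSublattice.map (dHull D φ).subtype (VectorSublattice.eqLocus S T)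
  have hL : ∀ z : dHull D φ, (z : G) ∈ L → S z = T z := fun z hz => by
    obtain ⟨z', hz', hzz⟩ := VectorSublattice.mem_map.1 hz
    obtain rfl : z' = z := Subtype.ext hzz
    exact hz'
  have key : (dHull D φ : Set G) ⊆ L := by
    refine dHull_induction (fun x => VectorSublattice.mem_map.2 ⟨toDHull D φ x, h x, rfl⟩) ?_
    intro k _ a b ha hb haL hab
    have hab' : CalcEq k (fun i => (⟨a i, ha i⟩ : dHull D φ)) ⟨b, hb⟩ := CalcEq.of_coe hab
    have h1 := hab'.map S
    rw [show (fun i => S ⟨a i, ha i⟩) = fun i => T ⟨a i, ha i⟩ from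
      funext fun i => hL ⟨a i, ha i⟩ (haL i)] at h1
    exact VectorSublattice.mem_map.2 ⟨⟨b, hb⟩, h1.unique hF (hab'.map T), rfl⟩
  exact VLHom.ext fun z => hL z (key z.2)

end Hull

/-! ### Universal property and uniqueness -/

section Completion

variable {E : Type u} [AddCommGroup E] [Lattice E] [Module ℝ E] [IsOrderedAddMonoid E]
  [IsOrderedModule ℝ E] {U : Type v} [AddCommGroup U] [Lattice U] [Module ℝ U]
  [IsOrderedAddMonoid U] [IsOrderedModule ℝ U]

theorem RUGenerates.isDCompletion_toDHull {φ : VLHom E U} (hφ : RUGenerates φ)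
    (hinj : Function.Injective φ) (hU : IsArchimedean U) (hc : UniformlyComplete U)
    (D : Set HFun) : IsDCompletion.{u, v, w} D (toDHull D φ) where
  archimedean := (dHull D φ).isArchimedean hU
  dComplete := dComplete_dHull hU hc D φ
  injective x y h := hinj (congrArg Subtype.val h)
  universal F _ _ _ _ _ hF hFD T := by
    -- `F` need not be uniformly complete, so the extension is built into its uniform completion `V`
    -- and then shown to land in `j(F)` on the hull.
    obtain ⟨V, _, _, _, _, _, j, hV, hVc, hj, -⟩ := hF.exists_ruGenerates
    obtain ⟨S, hS⟩ := hφ.exists_extension hinj hV hVc (j.comp T)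
    have hmem : (dHull D φ : Set U) ⊆ VectorSublattice.comap S j.range := by
      refine dHull_induction (fun x => ⟨T x, (hS x).symm⟩) fun h hh a b _ _ ha hab => ?_
      choose c hc using ha
      -- `F` supplies `d = h(c)`; then `j d` and `S b` are both `h` of the same elements of `V`,
      -- hence equal.
      obtain ⟨d, hd⟩ := hFD h hh c
      have h1 := hd.map j
      rw [show (fun i => j (c i)) = fun i => S (a i) from funext hc] at h1
      exact ⟨d, h1.unique hV (hab.map S)⟩
    let j' : VLHom F j.range := j.codRestrict j.range fun x => ⟨x, rfl⟩
    have hj' : Function.Bijective j' :=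
      ⟨fun x y h => hj (congrArg Subtype.val h), fun ⟨_, x, hx⟩ => ⟨x, Subtype.ext hx⟩⟩
    let R : VLHom (dHull D φ) F := (j'.inverse hj').comp
      ((S.comp (dHull D φ).subtype).codRestrict j.range fun y => hmem y.2)
    have hR : ∀ x, R (toDHull D φ x) = T x := fun x =>
      (congrArg (j'.inverse hj') (Subtype.ext (hS x))).trans (j'.inverse_apply hj' (T x))
    exact ⟨R, hR, fun R' hR' =>
      eq_of_comp_toDHull_eq hF fun x => (hR' x).trans (hR x).symm⟩

/-- Two `D`-completions are isomorphic over `E` by a unique isomorphism. -/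
theorem IsDCompletion.existsUnique_iso {D : Set HFun} {φ : VLHom E U} {G : Type v}
    [AddCommGroup G] [Lattice G] [Module ℝ G] [IsOrderedAddMonoid G] [IsOrderedModule ℝ G]
    {ψ : VLHom E G} (hφ : IsDCompletion.{u, v, v} D φ) (hψ : IsDCompletion.{u, v, v} D ψ) :
    ∃! e : VLHom U G, Function.Bijective e ∧ ∀ x, e (φ x) = ψ x := by
  obtain ⟨e, he, huniq⟩ := hφ.universal G hψ.archimedean hψ.dComplete ψ
  obtain ⟨f, hf, -⟩ := hψ.universal U hφ.archimedean hφ.dComplete φ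
  have hfe : f.comp e = VLHom.id :=
    (hφ.universal U hφ.archimedean hφ.dComplete φ).unique
      (fun x => by rw [VLHom.comp_apply, he, hf]) fun _ => rfl
  have hef : e.comp f = VLHom.id :=
    (hψ.universal G hψ.archimedean hψ.dComplete ψ).unique
      (fun x => by rw [VLHom.comp_apply, hf, he]) fun _ => rfl
  exact ⟨e, ⟨Function.bijective_iff_has_inverse.2
    ⟨f, fun x => DFunLike.congr_fun hfe x, fun y => DFunLike.congr_fun hef y⟩, he⟩,
    fun e' he' => huniq e' he'.2⟩

end Completion

end FunctionalCompletion

theorem corollary3p19 (E : Type u) [AddCommGroup E] [Lattice E] [Module ℝ E]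
    [IsOrderedAddMonoid E] [IsOrderedModule ℝ E] (hE : FunctionalCompletion.IsArchimedean E)
    (D : Set FunctionalCompletion.HFun) (hD : D.Nonempty) :
    -- a uniform completion of `E` exists
    (∃ (U : Type u) (_ : AddCommGroup U) (_ : Lattice U) (_ : Module ℝ U)
      (_ : IsOrderedAddMonoid U) (_ : IsOrderedModule ℝ U) (φ : FunctionalCompletion.VLHom E U),
      FunctionalCompletion.IsUniformCompletion.{u, u, max u w} φ) ∧
    -- inside any uniform completion, `E^D` with the natural embedding is a `D`-completion, and
    -- every `D`-completion is isomorphic to it by a unique isomorphism over `E`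
    ∀ (U : Type u) [AddCommGroup U] [Lattice U] [Module ℝ U] [IsOrderedAddMonoid U]
      [IsOrderedModule ℝ U] (φ : FunctionalCompletion.VLHom E U),
      FunctionalCompletion.IsUniformCompletion.{u, u, u} φ →
      FunctionalCompletion.IsDCompletion.{u, u, max u w} D (FunctionalCompletion.toDHull D φ) ∧
      ∀ (G : Type u) [AddCommGroup G] [Lattice G] [Module ℝ G] [IsOrderedAddMonoid G]
        [IsOrderedModule ℝ G] (ψ : FunctionalCompletion.VLHom E G),
        FunctionalCompletion.IsDCompletion.{u, u, u} D ψ →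
        ∃! e : FunctionalCompletion.VLHom (FunctionalCompletion.dHull D φ) G,
          Function.Bijective e ∧ ∀ x : E, e (FunctionalCompletion.toDHull D φ x) = ψ x := by
  refine ⟨?_, ?_⟩
  · obtain ⟨U, _, _, _, _, _, φ, hU, hc, hinj, hφ⟩ := hE.exists_ruGenerates
    exact ⟨U, inferInstance, inferInstance, inferInstance, inferInstance, inferInstance, φ,
      hφ.isUniformCompletion hinj hU hc⟩
  · intro U _ _ _ _ _ φ hφ
    -- Passing through `RUGenerates`, which mentions no test objects, lifts a universal property
    -- tested in `Type u` to one tested in the larger universe.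
    exact ⟨hφ.ruGenerates.isDCompletion_toDHull hφ.injective hφ.archimedean
      hφ.uniformlyComplete D, fun G _ _ _ _ _ ψ hψ =>
      (hφ.ruGenerates.isDCompletion_toDHull hφ.injective hφ.archimedean
        hφ.uniformlyComplete D).existsUnique_iso hψ⟩
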